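/- Let $E=(E^0,E^1,s,r)$ be a finite directed graph (i.e. $E^0$ and $E^1$ are finite sets) and let $R$ be an associative, not necessarily commutative, ring with identity $1\neq 0$. The Leavitt path algebra $L_R(E)$ is the $R$-algebra generated by symbols $v$ ($v\in E^0$) and $f,f^*$ ($f\in E^1$), where $R$ commutes with the generators, subject to the relations (1) $vw=\delta_{v,w}v$ for $v,w\in E^0$; (2) $s(f)f=f\,r(f)=f$ and $r(f)f^*=f^*s(f)=f^*$ for $f\in E^1$; (3) $f^*g=\delta_{f,g}\,r(f)$ for $f,g\in E^1$; (4) $\sum_{f\in E^1,\ s(f)=v}ff^*=v$ for every $v\in E^0$ for which $s^{-1}(v)$ is non-empty and finite. A path of length $n\ge 1$ is a sequence of edges $\alpha=f_1\cdots f_n$ with $s(f_{i+1})=r(f_i)$ for $1\le i\le n-1$; we put $s(\alpha)=s(f_1)$, $r(\alpha)=r(f_n)$ and $\alpha^*=f_n^*\cdots f_1^*$. The paths of length $0$ are the vertices $v$, with $s(v)=r(v)=v$ and $v^*=v$. Let $(L_R(E))_0$ be the degree-zero component of the canonical $\mathbb{Z}$-grading of $L_R(E)$, that is, the subring of all finite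 sums $\sum_i r_i\alpha_i\beta_i^*$ with $r_i\in R$ and $\alpha_i,\beta_i$ paths such that $r(\alpha_i)=r(\beta_i)$ and $\operatorname{len}(\alpha_i)=\operatorname{len}(\beta_i)$. A cycle is a path $f_1\cdots f_n$, $n\geq 1$, with $s(f_1)=r(f_n)$ and $s(f_i)\neq s(f_1)$ for $2\le i\le n$. An exit of it is an edge $e$ such that $s(e)=s(f_i)$ and $e\ne f_i$ for some $i$. The graph $E$ satisfies Condition (NE) if no cycle in $E$ has an exit. If $R$ is left noetherian, then the following are equivalent: (a) $E$ satisfies Condition (NE); (b) the ring $(L_R(E))_0$ is left noetherian; (c) the ring $L_R(E)$ is left noetherian. The same holds with "left" replaced by "right" throughout (in the hypothesis on $R$ and in (b) and (c)). -/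

import Mathlib

/-- A directed graph `(V, A, s, r)` with vertex set `V`, edge set `A`, source map `s` and range
map `r`. Loops and parallel edges are allowed. -/
structure DirectedGraph (V : Type*) (A : Type*) where
  s : A → V
  r : A → V

namespace DirectedGraph

variable {V A : Type*} (E : DirectedGraph V A)

/-- `E.IsPath u p w`: the list of edges `p = [f₁, …, fₙ]` is a path from `u` to `w`, i.e.
`s f₁ = u`, `s fᵢ₊₁ = r fᵢ` and `r fₙ = w`. The empty list is the path of length `0` at a
vertex. -/
def IsPath : V → List A → V → Prop
  | u, [], w => u = w
  | u, f :: p, w => E.s f = u ∧ IsPath (E.r f) p w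

/-- A cycle is a path `f₁ f₂ ⋯ fₙ` with `n ≥ 1`, `s f₁ = r fₙ` and `s fᵢ ≠ s f₁` for
`2 ≤ i ≤ n`. -/
def IsCycle : List A → Prop
  | [] => False
  | f :: p => E.IsPath (E.s f) (f :: p) (E.s f) ∧ ∀ g ∈ p, E.s g ≠ E.s f

/-- `e` is an exit of `f₁ ⋯ fₙ` if `s e = s fᵢ` and `e ≠ fᵢ` for some `i`. -/
def IsExit (e : A) (c : List A) : Prop :=
  ∃ f ∈ c, E.s e = E.s f ∧ e ≠ f

/-- Condition (NE): no cycle has an exit. -/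
def ConditionNE : Prop :=
  ∀ c : List A, E.IsCycle c → ¬ ∃ e : A, E.IsExit e c

end DirectedGraph

namespace Leavitt

open DirectedGraph

/-- The generators `v`, `f` and `f*` of a Leavitt path algebra. -/
inductive Gen (V : Type*) (A : Type*)
  | vertex (v : V)
  | edge (f : A)
  | ghost (f : A)

/-- The free (not necessarily unital) `R`-ring on the generators, in which the elements of `R`
commute with the generators: the semigroup ring over `R` of the nonempty words. -/
abbrev Free (R V A : Type*) [Ring R] := MonoidAlgebra R (FreeSemigroup (Gen V A))

section

variable {R V A : Type*} [Ring R]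

/-- The vertex `v` as an element of the free ring. -/
noncomputable def fv (v : V) : Free R V A := .single (.of (.vertex v)) 1

/-- The real edge `f` as an element of the free ring. -/
noncomputable def fe (f : A) : Free R V A := .single (.of (.edge f)) 1

/-- The ghost edge `f*` as an element of the free ring. -/
noncomputable def fg (f : A) : Free R V A := .single (.of (.ghost f)) 1

end

/-- The defining relations of the Leavitt path algebra. -/
inductive Rel (R : Type*) [Ring R] {V A : Type*} (E : DirectedGraph V A) :
    Free R V A → Free R V A → Prop
  | vertex_mul_self (v : V) : Rel R E (fv v * fv v) (fv v)
  | vertex_mul_of_ne (v w : V) (h : v ≠ w) : Rel R E (fv v * fv w) 0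
  | source_mul_edge (f : A) : Rel R E (fv (E.s f) * fe f) (fe f)
  | edge_mul_range (f : A) : Rel R E (fe f * fv (E.r f)) (fe f)
  | range_mul_ghost (f : A) : Rel R E (fv (E.r f) * fg f) (fg f)
  | ghost_mul_source (f : A) : Rel R E (fg f * fv (E.s f)) (fg f)
  | ghost_mul_edge_self (f : A) : Rel R E (fg f * fe f) (fv (E.r f))
  | ghost_mul_edge_of_ne (f g : A) (h : f ≠ g) : Rel R E (fg f * fe g) 0
  | sum_edge_mul_ghost (v : V) (hfin : {f : A | E.s f = v}.Finite)
      (hne : {f : A | E.s f = v}.Nonempty) :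
      Rel R E (∑ f ∈ hfin.toFinset, fe f * fg f) (fv v)

/-- The congruence generated by the defining relations and their `R`-multiples. -/
noncomputable def con (R : Type*) [Ring R] {V A : Type*} (E : DirectedGraph V A) : RingCon (Free R V A) :=
  ringConGen fun x y => ∃ (r : R) (a b : Free R V A), Rel R E a b ∧ x = r • a ∧ y = r • b

theorem con_smul {R : Type*} [Ring R] {V A : Type*} (E : DirectedGraph V A) (r : R)
    {x y : Free R V A} (h : con R E x y) : con R E (r • x) (r • y) := by
  induction h with
  | of x y h =>
    obtain ⟨t, a, b, hab, rfl, rfl⟩ := h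
    exact RingConGen.Rel.of _ _ ⟨r * t, a, b, hab, (mul_smul ..).symm, (mul_smul ..).symm⟩
  | refl x => exact (con R E).refl _
  | symm _ ih => exact (con R E).symm ih
  | trans _ _ ih₁ ih₂ => exact (con R E).trans ih₁ ih₂
  | add _ _ ih₁ ih₂ =>
    rw [smul_add, smul_add]
    exact (con R E).add ih₁ ih₂
  | mul _ h₂ ih₁ _ =>
    rw [← smul_mul_assoc, ← smul_mul_assoc]
    exact (con R E).mul ih₁ h₂

end Leavitt

/-- The Leavitt path algebra `L_R(E)` of a directed graph `E` with coefficients in a ring `R`: the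
(not necessarily unital) `R`-algebra on the generators `v`, `f`, `f*` and the relations above, with
`R` commuting with the generators. -/
def LeavittPathAlgebra (R : Type*) [Ring R] {V A : Type*} (E : DirectedGraph V A) : Type _ :=
  (Leavitt.con R E).Quotient

namespace LeavittPathAlgebra

open Leavitt

variable (R : Type*) [Ring R] {V A : Type*} (E : DirectedGraph V A)

noncomputable instance instNonUnitalRing : NonUnitalRing (LeavittPathAlgebra R E) :=
  inferInstanceAs (NonUnitalRing (con R E).Quotient)

/-- The quotient map from the free ring. -/
noncomputable def mk : Free R V A →ₙ+* LeavittPathAlgebra R E where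
  toFun x := ((x : (con R E).Quotient))
  map_mul' _ _ := rfl
  map_zero' := rfl
  map_add' _ _ := rfl

theorem mk_surjective : Function.Surjective (mk R E) :=
  Quotient.mk''_surjective

variable {R E} in
theorem mk_eq_of_rel {x y : Free R V A} (h : Rel R E x y) : mk R E x = mk R E y :=
  Quotient.sound (RingConGen.Rel.of _ _ ⟨1, x, y, h, (one_smul ..).symm, (one_smul ..).symm⟩)

noncomputable instance instSMul : SMul R (LeavittPathAlgebra R E) where
  smul r := Quotient.map' (r • ·) fun _ _ h => con_smul E r h

theorem mk_smul (r : R) (x : Free R V A) : mk R E (r • x) = r • mk R E x := rfl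

noncomputable instance instModule : Module R (LeavittPathAlgebra R E) :=
  Function.Surjective.module R (mk R E : Free R V A →+ LeavittPathAlgebra R E)
    (mk_surjective R E) (mk_smul R E)

instance instIsScalarTower : IsScalarTower R (LeavittPathAlgebra R E) (LeavittPathAlgebra R E) where
  smul_assoc r x y := by
    obtain ⟨x, rfl⟩ := mk_surjective R E x
    obtain ⟨y, rfl⟩ := mk_surjective R E y
    simp only [smul_eq_mul, ← mk_smul, ← map_mul, smul_mul_assoc]

/-- A vertex as an element of the Leavitt path algebra. -/
noncomputable def vertex (v : V) : LeavittPathAlgebra R E := mk R E (fv v)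

/-- A real edge as an element of the Leavitt path algebra. -/
noncomputable def edge (f : A) : LeavittPathAlgebra R E := mk R E (fe f)

/-- A ghost edge as an element of the Leavitt path algebra. -/
noncomputable def ghost (f : A) : LeavittPathAlgebra R E := mk R E (fg f)

section relations

variable {R E}

theorem vertex_mul_self (v : V) : vertex R E v * vertex R E v = vertex R E v := by
  simpa only [vertex, edge, ghost, map_mul] using mk_eq_of_rel (Rel.vertex_mul_self (R := R) (E := E) v)

theorem vertex_mul_of_ne {v w : V} (h : v ≠ w) : vertex R E v * vertex R E w = 0 := by
  simpa only [vertex, edge, ghost, map_mul, map_zero] using mk_eq_of_rel (Rel.vertex_mul_of_ne (R := R) (E := E) v w h)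

theorem source_mul_edge (f : A) : vertex R E (E.s f) * edge R E f = edge R E f := by
  simpa only [vertex, edge, ghost, map_mul] using mk_eq_of_rel (Rel.source_mul_edge (R := R) (E := E) f)

theorem edge_mul_range (f : A) : edge R E f * vertex R E (E.r f) = edge R E f := by
  simpa only [vertex, edge, ghost, map_mul] using mk_eq_of_rel (Rel.edge_mul_range (R := R) (E := E) f)

theorem range_mul_ghost (f : A) : vertex R E (E.r f) * ghost R E f = ghost R E f := by
  simpa only [vertex, edge, ghost, map_mul] using mk_eq_of_rel (Rel.range_mul_ghost (R := R) (E := E) f)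

theorem ghost_mul_source (f : A) : ghost R E f * vertex R E (E.s f) = ghost R E f := by
  simpa only [vertex, edge, ghost, map_mul] using mk_eq_of_rel (Rel.ghost_mul_source (R := R) (E := E) f)

theorem ghost_mul_edge_self (f : A) : ghost R E f * edge R E f = vertex R E (E.r f) := by
  simpa only [vertex, edge, ghost, map_mul] using mk_eq_of_rel (Rel.ghost_mul_edge_self (R := R) (E := E) f)

theorem ghost_mul_edge_of_ne {f g : A} (h : f ≠ g) : ghost R E f * edge R E g = 0 := by
  simpa only [vertex, edge, ghost, map_mul, map_zero] using
    mk_eq_of_rel (Rel.ghost_mul_edge_of_ne (R := R) (E := E) f g h)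

theorem single_mul_smul (g : Gen V A) (r : R) (x : Free R V A) :
    (.single (.of g) 1 * (r • x) : Free R V A) = r • (.single (.of g) 1 * x) := by
  induction x using MonoidAlgebra.induction_linear with
  | zero => simp
  | add x y hx hy => rw [smul_add, mul_add, mul_add, smul_add, hx, hy]
  | single m t => simp [MonoidAlgebra.single_mul_single]

theorem vertex_mul_smul (v : V) (r : R) (x : LeavittPathAlgebra R E) :
    vertex R E v * (r • x) = r • (vertex R E v * x) := by
  obtain ⟨x, rfl⟩ := mk_surjective R E x
  simp only [vertex, ← mk_smul, ← map_mul, fv, single_mul_smul]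

theorem edge_mul_smul (f : A) (r : R) (x : LeavittPathAlgebra R E) :
    edge R E f * (r • x) = r • (edge R E f * x) := by
  obtain ⟨x, rfl⟩ := mk_surjective R E x
  simp only [edge, ← mk_smul, ← map_mul, fe, single_mul_smul]

theorem ghost_mul_smul (f : A) (r : R) (x : LeavittPathAlgebra R E) :
    ghost R E f * (r • x) = r • (ghost R E f * x) := by
  obtain ⟨x, rfl⟩ := mk_surjective R E x
  simp only [ghost, ← mk_smul, ← map_mul, fg, single_mul_smul]

theorem mk_single (m : FreeSemigroup (Gen V A)) (r : R) :
    mk R E (.single m r) = r • mk R E (.single m 1) := by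
  rw [← mk_smul, MonoidAlgebra.smul_single, smul_eq_mul, mul_one]

end relations

section unit

/-! For finitely many vertices, the sum of the vertices is an identity element. -/

variable {R E} [Fintype V]

theorem sum_vertex_mul_vertex (v : V) :
    (∑ u, vertex R E u) * vertex R E v = vertex R E v := by
  classical
  rw [Finset.sum_mul, Finset.sum_eq_single v (fun u _ h => vertex_mul_of_ne h)
    (fun h => absurd (Finset.mem_univ v) h), vertex_mul_self]

theorem vertex_mul_sum_vertex (v : V) :
    vertex R E v * (∑ u, vertex R E u) = vertex R E v := by
  classical
  rw [Finset.mul_sum, Finset.sum_eq_single v (fun u _ h => vertex_mul_of_ne h.symm)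
    (fun h => absurd (Finset.mem_univ v) h), vertex_mul_self]

theorem sum_vertex_mul_gen (g : Gen V A) :
    (∑ u, vertex R E u) * mk R E (.single (.of g) 1) = mk R E (.single (.of g) 1) := by
  cases g with
  | vertex v => exact sum_vertex_mul_vertex v
  | edge f =>
    change _ * edge R E f = edge R E f
    rw [← source_mul_edge, ← mul_assoc, sum_vertex_mul_vertex]
  | ghost f =>
    change _ * ghost R E f = ghost R E f
    rw [← range_mul_ghost, ← mul_assoc, sum_vertex_mul_vertex]

theorem gen_mul_sum_vertex (g : Gen V A) :
    mk R E (.single (.of g) 1) * (∑ u, vertex R E u) = mk R E (.single (.of g) 1) := by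
  cases g with
  | vertex v => exact vertex_mul_sum_vertex v
  | edge f =>
    change edge R E f * _ = edge R E f
    rw [← edge_mul_range, mul_assoc, vertex_mul_sum_vertex]
  | ghost f =>
    change ghost R E f * _ = ghost R E f
    rw [← ghost_mul_source, mul_assoc, vertex_mul_sum_vertex]

theorem sum_vertex_mul_smul (r : R) (x : LeavittPathAlgebra R E) :
    (∑ u, vertex R E u) * (r • x) = r • ((∑ u, vertex R E u) * x) := by
  simp only [Finset.sum_mul, Finset.smul_sum, vertex_mul_smul]

theorem sum_vertex_mul (x : LeavittPathAlgebra R E) : (∑ u, vertex R E u) * x = x := by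
  obtain ⟨x, rfl⟩ := mk_surjective R E x
  induction x using MonoidAlgebra.induction_linear with
  | zero => simp
  | add x y hx hy => rw [map_add, mul_add, hx, hy]
  | single m r =>
    rw [mk_single, sum_vertex_mul_smul]
    congr 1
    induction m using FreeSemigroup.recOnMul with
    | ih1 g => exact sum_vertex_mul_gen g
    | ih2 g m hg _ =>
      have : (.single (.of g * m) 1 : Free R V A) = .single (.of g) 1 * .single m 1 := by
        rw [MonoidAlgebra.single_mul_single, one_mul]
      rw [this, map_mul, ← mul_assoc, hg]

theorem mul_sum_vertex (x : LeavittPathAlgebra R E) : x * (∑ u, vertex R E u) = x := by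
  obtain ⟨x, rfl⟩ := mk_surjective R E x
  induction x using MonoidAlgebra.induction_linear with
  | zero => simp
  | add x y hx hy => rw [map_add, add_mul, hx, hy]
  | single m r =>
    rw [mk_single, smul_mul_assoc]
    congr 1
    induction m using FreeSemigroup.recOnMul with
    | ih1 g => exact gen_mul_sum_vertex g
    | ih2 g m _ hm =>
      have : (.single (.of g * m) 1 : Free R V A) = .single (.of g) 1 * .single m 1 := by
        rw [MonoidAlgebra.single_mul_single, one_mul]
      rw [this, map_mul, mul_assoc, hm]

end unit

open Classical in
/-- If `E` has finitely many vertices, then `L_R(E)` is a unital ring, with `1 = ∑ v`. -/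
noncomputable instance instRing [Finite V] : Ring (LeavittPathAlgebra R E) :=
  letI := Fintype.ofFinite V
  { instNonUnitalRing R E with
    one := ∑ v, vertex R E v
    one_mul := sum_vertex_mul
    mul_one := mul_sum_vertex }

/-- The element `α = f₁ f₂ ⋯ fₙ` for a path `α` starting at `u` (for `n = 0` it is the vertex `u`,
and for `n ≥ 1` the trailing factor `r fₙ` is absorbed by `fₙ`). -/
noncomputable def path : V → List A → LeavittPathAlgebra R E
  | u, [] => vertex R E u
  | _, f :: p => edge R E f * path (E.r f) p

/-- The element `α* = fₙ* ⋯ f₂* f₁*` for a path `α = f₁ f₂ ⋯ fₙ` starting at `u`. -/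
noncomputable def ghostPath : V → List A → LeavittPathAlgebra R E
  | u, [] => vertex R E u
  | _, f :: p => ghostPath (E.r f) p * ghost R E f

/-- The homogeneous component `(L_R(E))_n` of the canonical `ℤ`-grading: all finite sums of
elements `c α β*` with `c ∈ R`, where `α` and `β` are paths with the same range `w` and
`len α - len β = n`. -/
noncomputable def component (n : ℤ) : AddSubgroup (LeavittPathAlgebra R E) :=
  AddSubgroup.closure {x | ∃ (c : R) (u v w : V) (α β : List A), E.IsPath u α w ∧ E.IsPath v β w ∧
    (α.length : ℤ) - (β.length : ℤ) = n ∧ x = c • (path R E u α * ghostPath R E v β)}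

section grading

variable {R E}

theorem isPath_append {u v w : V} {p q : List A} (hp : E.IsPath u p v) (hq : E.IsPath v q w) :
    E.IsPath u (p ++ q) w := by
  induction p generalizing u with
  | nil => cases hp; exact hq
  | cons f p ih => exact ⟨hp.1, ih hp.2⟩

theorem vertex_mul_path {u w : V} {p : List A} (h : E.IsPath u p w) :
    vertex R E u * path R E u p = path R E u p := by
  cases p with
  | nil => exact vertex_mul_self u
  | cons f p => rw [path, ← mul_assoc, ← h.1, source_mul_edge]

theorem ghostPath_mul_vertex {u w : V} {p : List A} (h : E.IsPath u p w) :
    ghostPath R E u p * vertex R E u = ghostPath R E u p := by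
  cases p with
  | nil => exact vertex_mul_self u
  | cons f p => rw [ghostPath, mul_assoc, ← h.1, ghost_mul_source]

theorem path_append {u v w : V} {p q : List A} (hp : E.IsPath u p v) (hq : E.IsPath v q w) :
    path R E u (p ++ q) = path R E u p * path R E v q := by
  induction p generalizing u with
  | nil => cases hp; exact (vertex_mul_path hq).symm
  | cons f p ih => rw [List.cons_append, path, path, ih hp.2, mul_assoc]

theorem ghostPath_append {u v w : V} {p q : List A} (hp : E.IsPath u p v) (hq : E.IsPath v q w) :
    ghostPath R E u (p ++ q) = ghostPath R E v q * ghostPath R E u p := by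
  induction p generalizing u with
  | nil => cases hp; exact (ghostPath_mul_vertex hq).symm
  | cons f p ih => rw [List.cons_append, ghostPath, ghostPath, ih hp.2, mul_assoc]

theorem path_mul_smul (u : V) (p : List A) (r : R) (x : LeavittPathAlgebra R E) :
    path R E u p * (r • x) = r • (path R E u p * x) := by
  induction p generalizing u with
  | nil => exact vertex_mul_smul u r x
  | cons f p ih => rw [path, mul_assoc, ih, edge_mul_smul, mul_assoc]

theorem ghostPath_mul_smul (u : V) (p : List A) (r : R) (x : LeavittPathAlgebra R E) :
    ghostPath R E u p * (r • x) = r • (ghostPath R E u p * x) := by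
  induction p generalizing u x with
  | nil => exact vertex_mul_smul u r x
  | cons f p ih => rw [ghostPath, mul_assoc, ghost_mul_smul, ih, mul_assoc]

theorem ghostPath_mul_path {v w v' w' : V} {β γ : List A} (hβ : E.IsPath v β w)
    (hγ : E.IsPath v' γ w') :
    ghostPath R E v β * path R E v' γ = 0 ∨
    (∃ τ, β = γ ++ τ ∧ E.IsPath w' τ w ∧
      ghostPath R E v β * path R E v' γ = ghostPath R E w' τ) ∨
    (∃ τ, γ = β ++ τ ∧ E.IsPath w τ w' ∧
      ghostPath R E v β * path R E v' γ = path R E w τ) := by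
  by_cases hv : v = v'
  · subst hv
    induction β generalizing v γ with
    | nil =>
      cases hβ
      exact .inr (.inr ⟨γ, rfl, hγ, vertex_mul_path hγ⟩)
    | cons f β ih =>
      cases γ with
      | nil =>
        cases hγ
        exact .inr (.inl ⟨f :: β, rfl, hβ, ghostPath_mul_vertex hβ⟩)
      | cons g γ =>
        by_cases hfg : f = g
        · subst hfg
          have key : ghostPath R E v (f :: β) * path R E v (f :: γ) =
              ghostPath R E (E.r f) β * path R E (E.r f) γ := by
            rw [ghostPath, path, mul_assoc, ← mul_assoc (ghost R E f), ghost_mul_edge_self,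
              vertex_mul_path hγ.2]
          rw [key]
          rcases ih hβ.2 hγ.2 with h | ⟨τ, rfl, h₁, h₂⟩ | ⟨τ, rfl, h₁, h₂⟩
          · exact .inl h
          · exact .inr (.inl ⟨τ, rfl, h₁, h₂⟩)
          · exact .inr (.inr ⟨τ, rfl, h₁, h₂⟩)
        · left
          rw [ghostPath, path, mul_assoc, ← mul_assoc (ghost R E f), ghost_mul_edge_of_ne hfg,
            zero_mul, mul_zero]
  · left
    rw [← ghostPath_mul_vertex hβ, ← vertex_mul_path hγ, mul_assoc, ← mul_assoc (vertex R E v),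
      vertex_mul_of_ne hv, zero_mul, mul_zero]

theorem mul_mem_component {m n : ℤ} {x y : LeavittPathAlgebra R E} (hx : x ∈ component R E m)
    (hy : y ∈ component R E n) : x * y ∈ component R E (m + n) := by
  induction hx using AddSubgroup.closure_induction with
  | zero => rw [zero_mul]; exact zero_mem _
  | add _ _ _ _ h₁ h₂ => rw [add_mul]; exact add_mem h₁ h₂
  | neg _ _ h => rw [neg_mul]; exact neg_mem h
  | mem x hx =>
    induction hy using AddSubgroup.closure_induction with
    | zero => rw [mul_zero]; exact zero_mem _
    | add _ _ _ _ h₁ h₂ => rw [mul_add]; exact add_mem h₁ h₂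
    | neg _ _ h => rw [mul_neg]; exact neg_mem h
    | mem y hy =>
      obtain ⟨c, u, v, w, α, β, hα, hβ, hm, rfl⟩ := hx
      obtain ⟨d, v', t, w', γ, δ, hγ, hδ, hn, rfl⟩ := hy
      have key : (c • (path R E u α * ghostPath R E v β)) *
          (d • (path R E v' γ * ghostPath R E t δ)) =
          (c * d) • (path R E u α * (ghostPath R E v β * path R E v' γ) * ghostPath R E t δ) := by
        rw [smul_mul_assoc, mul_assoc, ghostPath_mul_smul, path_mul_smul, smul_smul]
        simp only [mul_assoc]
      rw [key]
      rcases ghostPath_mul_path (R := R) hβ hγ with h | ⟨τ, rfl, hτ, h⟩ | ⟨τ, rfl, hτ, h⟩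
      · rw [h, mul_zero, zero_mul, smul_zero]
        exact zero_mem _
      · refine AddSubgroup.subset_closure
          ⟨c * d, u, t, w, α, δ ++ τ, hα, isPath_append hδ hτ, ?_, ?_⟩
        · simp only [List.length_append, Nat.cast_add] at *
          lia
        · rw [h, ghostPath_append hδ hτ, mul_assoc]
      · refine AddSubgroup.subset_closure
          ⟨c * d, u, t, w', α ++ τ, δ, isPath_append hα hτ, hδ, ?_, ?_⟩
        · simp only [List.length_append, Nat.cast_add] at *
          lia
        · rw [h, path_append hα hτ]

theorem one_mem_component [Finite V] : (1 : LeavittPathAlgebra R E) ∈ component R E 0 := by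
  let _ := Fintype.ofFinite V
  change ∑ v, vertex R E v ∈ component R E 0
  refine sum_mem fun v _ => AddSubgroup.subset_closure ⟨1, v, v, v, [], [], rfl, rfl, rfl, ?_⟩
  rw [one_smul, path, ghostPath, vertex_mul_self]

end grading

/-- With this instance Mathlib makes `component R E 0` a ring, with the operations of `L_R(E)`. -/
instance instGradedMonoid [Finite V] : SetLike.GradedMonoid (component R E) where
  one_mem := one_mem_component
  mul_mem _ _ _ _ := mul_mem_component

end LeavittPathAlgebra

/-! Write `L` for the Leavitt path algebra and `L₀` for its component of degree zero. The proof goes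
NE ⇒ `L` noetherian ⇒ `L₀` noetherian ⇒ NE.

Without exits, a vertex on a closed path emits exactly one edge. The sum `u` of these edges and of
the vertices on no closed path is a unit of `L` (`shift`) commuting with `R`, so `L` is a left
`R[X]`-module with `X` acting as `u`. Only finitely many paths `p` stop on first reaching a sink or
a cycle, and relation (4) in effect gives `1 = ∑ p p*` over them. Let `M` be the `R[X]`-span of the
`p*`; it is noetherian by Hilbert's basis theorem. Right multiplication by elements of `L` preserves
`M` up to powers of `u`: for each `x` and `p`, some `u ^ k p* x` lies in `M`. As `u` is invertible,
`x = ∑ p p* x` lies in `L (M ∩ L x)`. Left ideals are thus determined by their traces on `M`, and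
chains of them become stationary.

The projection of `L` onto `L₀` is `L₀`-linear on both sides, so a left ideal `I` of `L₀` is
recovered from `L I`; hence `L₀` inherits the chain condition.

If a closed path `c` has an exit at its base, the elements `c ^ k (c*) ^ k` are strictly decreasing
idempotents of `L₀`, which is impossible in a noetherian ring. Strictness rests on `vertex_ne_zero`,
proved by an explicit representation.

For the right-hand version, exchanging real and ghost edges maps the algebra over `Rᵐᵒᵖ` onto
`Lᵐᵒᵖ`; the other two implications are symmetric. -/

/-! ### Chain conditions in noncommutative rings. -/

section NoetherianRings

open Polynomial in
/-- The left ideal of the `n`-th coefficients of the polynomials in `I` of degree at most `n`. -/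
def coeffIdeal {R : Type*} [Ring R] (I : Ideal R[X]) (n : ℕ) : Ideal R where
  carrier := {a | ∃ p ∈ I, p.natDegree ≤ n ∧ p.coeff n = a}
  zero_mem' := ⟨0, I.zero_mem, by simp, by simp⟩
  add_mem' := by
    rintro _ _ ⟨p, hp, hpn, rfl⟩ ⟨q, hq, hqn, rfl⟩
    exact ⟨p + q, I.add_mem hp hq, natDegree_add_le_of_degree_le hpn hqn, coeff_add ..⟩
  smul_mem' := by
    rintro c _ ⟨p, hp, hpn, rfl⟩
    exact ⟨C c * p, I.mul_mem_left _ hp, (natDegree_C_mul_le c p).trans hpn, coeff_C_mul p⟩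

open Polynomial in
theorem coeffIdeal_mono {R : Type*} [Ring R] {I J : Ideal R[X]} (h : I ≤ J) {m n : ℕ}
    (hmn : m ≤ n) : coeffIdeal I m ≤ coeffIdeal J n := by
  rintro _ ⟨p, hp, hpn, rfl⟩
  refine ⟨X ^ (n - m) * p, J.mul_mem_left _ (h hp), ?_, ?_⟩
  · refine natDegree_mul_le.trans ?_
    have := natDegree_X_pow_le (R := R) (n - m)
    lia
  · obtain ⟨k, rfl⟩ := Nat.exists_eq_add_of_le hmn
    rw [Nat.add_sub_cancel_left, coeff_X_pow_mul]

-- Induction on the degree: subtracting an element of `I` with the same top coefficient lowers the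
-- degree of an element of `J`.
open Polynomial in
theorem le_of_coeffIdeal_le {R : Type*} [Ring R] {I J : Ideal R[X]} (h : I ≤ J)
    (hc : ∀ n, coeffIdeal J n ≤ coeffIdeal I n) : J ≤ I := by
  have key : ∀ n : ℕ, ∀ p ∈ J, p.natDegree < n → p ∈ I := by
    intro n
    induction n with
    | zero => intro p _ hn; lia
    | succ n ih =>
      intro p hp hn
      obtain ⟨q, hq, hqn, hpq⟩ := hc n ⟨p, hp, by lia, rfl⟩
      rw [← sub_add_cancel p q]
      refine I.add_mem ?_ hq
      -- `natDegree` cannot drop below `0`, so for constants the difference itself has to vanish.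
      by_cases h0 : n = 0
      · subst h0
        have : p - q = 0 := by
          rw [eq_C_of_natDegree_le_zero (p := p) (by lia), eq_C_of_natDegree_le_zero hqn, hpq,
            sub_self]
        rw [this]
        exact I.zero_mem
      · refine ih _ (J.sub_mem hp (h hq)) ?_
        refine lt_of_le_of_ne (natDegree_sub_le_of_le (by lia : p.natDegree ≤ n) hqn |>.trans
          (by simp)) fun hd => ?_
        have h1 : (p - q).coeff n = 0 := by rw [coeff_sub, hpq, sub_self]
        rw [← hd, coeff_natDegree, leadingCoeff_eq_zero] at h1
        rw [h1, natDegree_zero] at hd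
        exact h0 hd.symm
  exact fun p hp => key _ p hp (Nat.lt_succ_self _)

open Polynomial in
/-- **Hilbert's basis theorem** over a not necessarily commutative ring. -/
theorem isNoetherianRing_polynomial (R : Type*) [Ring R] [IsNoetherianRing R] :
    IsNoetherianRing R[X] := by
  refine monotone_stabilizes_iff_noetherian.1 fun f => ?_
  -- The coefficient ideals increase in both indices. A maximal one, at `(K, N)`, settles all
  -- degrees from `N` on; the finitely many smaller degrees stabilise one at a time.
  obtain ⟨_, ⟨⟨K, N⟩, rfl⟩, hmax⟩ := set_has_maximal_iff_noetherian.2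
    (inferInstance : IsNoetherian R R) (Set.range fun x : ℕ × ℕ => coeffIdeal (f x.1) x.2)
    (Set.range_nonempty _)
  have hst : ∀ n, ∃ k, ∀ m, k ≤ m → coeffIdeal (f k) n = coeffIdeal (f m) n := fun n =>
    monotone_stabilizes_iff_noetherian.2 (inferInstance : IsNoetherian R R)
      ⟨fun k => coeffIdeal (f k) n, fun _ _ h => coeffIdeal_mono (f.monotone h) le_rfl⟩
  choose g hg using hst
  refine ⟨K ⊔ (Finset.range N).sup g, fun m hm => le_antisymm (f.monotone hm) ?_⟩
  refine le_of_coeffIdeal_le (f.monotone hm) fun n => ?_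
  rcases lt_or_ge n N with hn | hn
  · have h1 : g n ≤ K ⊔ (Finset.range N).sup g :=
      (Finset.le_sup (Finset.mem_range.2 hn)).trans le_sup_right
    rw [← hg n m (h1.trans hm), ← hg n _ h1]
  · have h1 : coeffIdeal (f K) N ≤ coeffIdeal (f m) n :=
      coeffIdeal_mono (f.monotone (le_sup_left.trans hm)) hn
    have h2 := hmax _ ⟨(m, n), rfl⟩
    refine ((not_lt_iff_le_imp_ge.1 h2) h1).trans ?_
    exact coeffIdeal_mono (f.monotone le_sup_left) hn

/-- A ring is left noetherian if its left ideals are determined by their intersections with a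
noetherian submodule over another ring. -/
theorem isNoetherianRing_of_mem_span_inf {B L : Type*} [Ring B] [Ring L] [Module B L]
    [IsScalarTower B L L] (M : Submodule B L) [IsNoetherian B M]
    (h : ∀ x : L, x ∈ Ideal.span ((M : Set L) ∩ Ideal.span {x})) : IsNoetherianRing L := by
  refine monotone_stabilizes_iff_noetherian.1 fun f => ?_
  obtain ⟨n, hn⟩ := monotone_stabilizes_iff_noetherian.2 (inferInstance : IsNoetherian B M)
    ⟨fun k => ((f k).restrictScalars B).comap M.subtype, fun _ _ h _ hx => f.monotone h hx⟩
  refine ⟨n, fun m hm => le_antisymm (f.monotone hm) fun x hx => ?_⟩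
  refine Ideal.span_le.2 ?_ (h x)
  rintro y ⟨hyM, hyx⟩
  have hy : y ∈ f m := (Ideal.span_singleton_le_iff_mem _).2 hx hyx
  have : (⟨y, hyM⟩ : M) ∈ ((f m).restrictScalars B).comap M.subtype := hy
  exact (SetLike.ext_iff.1 (hn m hm) _).2 this

/-- A subring with a right linear retraction inherits the left noetherian property. -/
theorem isNoetherianRing_of_retraction {S L : Type*} [Ring S] [Ring L] (i : S →+* L) (π : L →+ S)
    (hi : ∀ s, π (i s) = s) (hπ : ∀ x s, π (x * i s) = π x * s) [IsNoetherianRing L] :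
    IsNoetherianRing S := by
  refine monotone_stabilizes_iff_noetherian.1 fun f => ?_
  obtain ⟨n, hn⟩ := monotone_stabilizes_iff_noetherian.2 (inferInstance : IsNoetherian L L)
    ⟨fun k => Ideal.map i (f k), fun _ _ h => Ideal.map_mono (f.monotone h)⟩
  refine ⟨n, fun m hm => le_antisymm (f.monotone hm) fun a ha => ?_⟩
  -- The extended ideal consists of sums of terms `r * i s` with `s` in the ideal, and `π (r * i s)
  -- = π r * s`.
  have key : ∀ y ∈ Ideal.map i (f n), π y ∈ f n := by
    intro y hy
    rw [Ideal.map, Ideal.span] at hy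
    induction hy using Submodule.closure_induction with
    | zero => rw [map_zero]; exact zero_mem _
    | add x y _ _ hx hy => rw [map_add]; exact add_mem hx hy
    | smul_mem r x h =>
      obtain ⟨s, hs, rfl⟩ := h
      rw [smul_eq_mul, hπ]
      exact Ideal.mul_mem_left (f n) _ hs
  have h : i a ∈ Ideal.map i (f n) := (SetLike.ext_iff.1 (hn m hm) _).2 (Ideal.mem_map_of_mem i ha)
  simpa only [hi] using key _ h

/-- A strictly decreasing sequence of idempotents prevents a ring from being left noetherian. -/
theorem not_isNoetherianRing_of_idempotents {S : Type*} [Ring S] (p : ℕ → S)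
    (h₁ : ∀ k, p k * p (k + 1) = p (k + 1)) (h₂ : ∀ k, p (k + 1) * p k = p (k + 1))
    (h₃ : ∀ k, p k * p k = p k) (hne : ∀ k, p (k + 1) ≠ p k) : ¬ IsNoetherianRing S := by
  intro hS
  -- The inclusion comes from `(1 - p k) * (1 - p (k + 1)) = 1 - p k`.
  have hmono : Monotone fun k => Ideal.span {1 - p k} := by
    refine monotone_nat_of_le_succ fun k => (Ideal.span_singleton_le_iff_mem _).2 ?_
    refine Ideal.mem_span_singleton'.2 ⟨1 - p k, ?_⟩
    rw [mul_sub, sub_mul, sub_mul, h₁]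
    simp
  obtain ⟨n, hn⟩ := monotone_stabilizes_iff_noetherian.2 hS ⟨_, hmono⟩
  have h : (1 - p (n + 1)) ∈ Ideal.span {1 - p n} := by
    have := hn (n + 1) (Nat.le_succ n)
    simp only [OrderHom.coe_mk] at this
    rw [this]
    exact Ideal.mem_span_singleton_self _
  obtain ⟨a, ha⟩ := Ideal.mem_span_singleton'.1 h
  -- Right multiplication by `p n` annihilates the left ideal generated by `1 - p n`.
  have h0 : (1 - p (n + 1)) * p n = 0 := by
    rw [← ha, mul_assoc, sub_mul, h₃, one_mul, sub_self, mul_zero]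
  rw [sub_mul, one_mul, h₂, sub_eq_zero] at h0
  exact hne n h0.symm

end NoetherianRings


/-! ### The universal property and the scalars. -/

namespace LeavittPathAlgebra

open Leavitt DirectedGraph

section lift

variable {R V A Q : Type*} [Ring R] [Ring Q] {E : DirectedGraph V A}

/-- The ring homomorphism from the free ring that extends a ring homomorphism on the coefficients
and a family of elements that commute with its values. -/
noncomputable def freeLift (φ : R →+* Q) (g : Gen V A → Q) (hc : ∀ r x, Commute (φ r) (g x)) :
    Free R V A →ₙ+* Q where
  __ := MonoidAlgebra.liftNC (φ : R →+ Q) (FreeSemigroup.lift g)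
  map_mul' x y := by
    refine MonoidAlgebra.liftNC_mul φ (FreeSemigroup.lift g) x y fun {a b} hb => ?_
    clear hb
    induction b using FreeSemigroup.recOnMul with
    | ih1 x => exact hc _ x
    | ih2 x y h₁ h₂ =>
      rw [map_mul]
      exact h₁.mul_right h₂
  map_zero' := map_zero _
  map_add' x y := map_add (MonoidAlgebra.liftNC (φ : R →+ Q) (FreeSemigroup.lift g)) x y

theorem freeLift_single (φ : R →+* Q) (g : Gen V A → Q) (hc : ∀ r x, Commute (φ r) (g x))
    (x : Gen V A) : freeLift φ g hc (.single (.of x) 1) = g x := by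
  change MonoidAlgebra.liftNC (φ : R →+ Q) (FreeSemigroup.lift g) _ = _
  rw [MonoidAlgebra.liftNC_single]
  simp

theorem freeLift_smul (φ : R →+* Q) (g : Gen V A → Q) (hc : ∀ r x, Commute (φ r) (g x))
    (r : R) (x : Free R V A) : freeLift φ g hc (r • x) = φ r * freeLift φ g hc x := by
  change MonoidAlgebra.liftNC (φ : R →+ Q) (FreeSemigroup.lift g) _ =
    φ r * MonoidAlgebra.liftNC (φ : R →+ Q) (FreeSemigroup.lift g) _
  induction x using MonoidAlgebra.induction_linear with
  | zero => simp
  | add x y hx hy => rw [smul_add, map_add, hx, hy, map_add, mul_add]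
  | single m t =>
    rw [MonoidAlgebra.smul_single, MonoidAlgebra.liftNC_single, MonoidAlgebra.liftNC_single]
    simp [mul_assoc]

/-- A family of elements of a ring that satisfies the relations of the Leavitt path algebra of `E`.
-/
structure IsFamily (E : DirectedGraph V A) (g : Gen V A → Q) : Prop where
  vertex_mul_self (v : V) : g (.vertex v) * g (.vertex v) = g (.vertex v)
  vertex_mul_of_ne {v w : V} (h : v ≠ w) : g (.vertex v) * g (.vertex w) = 0
  source_mul_edge (f : A) : g (.vertex (E.s f)) * g (.edge f) = g (.edge f)
  edge_mul_range (f : A) : g (.edge f) * g (.vertex (E.r f)) = g (.edge f)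
  range_mul_ghost (f : A) : g (.vertex (E.r f)) * g (.ghost f) = g (.ghost f)
  ghost_mul_source (f : A) : g (.ghost f) * g (.vertex (E.s f)) = g (.ghost f)
  ghost_mul_edge_self (f : A) : g (.ghost f) * g (.edge f) = g (.vertex (E.r f))
  ghost_mul_edge_of_ne {f f' : A} (h : f ≠ f') : g (.ghost f) * g (.edge f') = 0
  sum_edge_mul_ghost (v : V) (hfin : {f : A | E.s f = v}.Finite)
    (hne : {f : A | E.s f = v}.Nonempty) :
    ∑ f ∈ hfin.toFinset, g (.edge f) * g (.ghost f) = g (.vertex v)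

theorem con_le_ker (φ : R →+* Q) (g : Gen V A → Q) (hc : ∀ r x, Commute (φ r) (g x))
    (hg : IsFamily E g) {x y : Free R V A} (h : con R E x y) :
    freeLift φ g hc x = freeLift φ g hc y := by
  induction h with
  | of x y h =>
    obtain ⟨t, a, b, hab, rfl, rfl⟩ := h
    rw [freeLift_smul, freeLift_smul]
    congr 1
    cases hab <;> simp only [map_mul, map_sum, map_zero, fv, fe, fg, freeLift_single]
    · exact hg.vertex_mul_self _
    · exact hg.vertex_mul_of_ne ‹_›
    · exact hg.source_mul_edge _
    · exact hg.edge_mul_range _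
    · exact hg.range_mul_ghost _
    · exact hg.ghost_mul_source _
    · exact hg.ghost_mul_edge_self _
    · exact hg.ghost_mul_edge_of_ne ‹_›
    · exact hg.sum_edge_mul_ghost _ _ ‹_›
  | refl x => rfl
  | symm _ ih => exact ih.symm
  | trans _ _ ih₁ ih₂ => exact ih₁.trans ih₂
  | add _ _ ih₁ ih₂ => rw [map_add, map_add, ih₁, ih₂]
  | mul _ _ ih₁ ih₂ => rw [map_mul, map_mul, ih₁, ih₂]

/-- The universal property of the Leavitt path algebra. -/
noncomputable def lift (φ : R →+* Q) (g : Gen V A → Q) (hc : ∀ r x, Commute (φ r) (g x))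
    (hg : IsFamily E g) : LeavittPathAlgebra R E →ₙ+* Q where
  toFun := Quotient.lift (freeLift φ g hc) fun _ _ h => con_le_ker φ g hc hg h
  map_mul' x y := by
    obtain ⟨x, rfl⟩ := mk_surjective R E x
    obtain ⟨y, rfl⟩ := mk_surjective R E y
    exact map_mul (freeLift φ g hc) x y
  map_zero' := map_zero (freeLift φ g hc)
  map_add' x y := by
    obtain ⟨x, rfl⟩ := mk_surjective R E x
    obtain ⟨y, rfl⟩ := mk_surjective R E y
    exact map_add (freeLift φ g hc) x y

/-- The image of a generator in the Leavitt path algebra. -/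
noncomputable def gen (R : Type*) [Ring R] (E : DirectedGraph V A) (x : Gen V A) :
    LeavittPathAlgebra R E := mk R E (.single (.of x) 1)

theorem lift_gen (φ : R →+* Q) (g : Gen V A → Q) (hc : ∀ r x, Commute (φ r) (g x))
    (hg : IsFamily E g) (x : Gen V A) : lift φ g hc hg (gen R E x) = g x :=
  freeLift_single φ g hc x

theorem lift_smul (φ : R →+* Q) (g : Gen V A → Q) (hc : ∀ r x, Commute (φ r) (g x))
    (hg : IsFamily E g) (r : R) (x : LeavittPathAlgebra R E) :
    lift φ g hc hg (r • x) = φ r * lift φ g hc hg x := by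
  obtain ⟨x, rfl⟩ := mk_surjective R E x
  exact freeLift_smul φ g hc r x

theorem sum_edge_mul_ghost (v : V) (hfin : {f : A | E.s f = v}.Finite)
    (hne : {f : A | E.s f = v}.Nonempty) :
    ∑ f ∈ hfin.toFinset, edge R E f * ghost R E f = vertex R E v := by
  simpa only [vertex, edge, ghost, map_mul, map_sum] using
    mk_eq_of_rel (Rel.sum_edge_mul_ghost (R := R) (E := E) v hfin hne)

theorem isFamily_gen [Finite V] : IsFamily E (gen R E) where
  vertex_mul_self := vertex_mul_self
  vertex_mul_of_ne := vertex_mul_of_ne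
  source_mul_edge := source_mul_edge
  edge_mul_range := edge_mul_range
  range_mul_ghost := range_mul_ghost
  ghost_mul_source := ghost_mul_source
  ghost_mul_edge_self := ghost_mul_edge_self
  ghost_mul_edge_of_ne := ghost_mul_edge_of_ne
  sum_edge_mul_ghost := sum_edge_mul_ghost

theorem gen_mul_smul (g : Gen V A) (r : R) (x : LeavittPathAlgebra R E) :
    gen R E g * (r • x) = r • (gen R E g * x) := by
  cases g
  · exact vertex_mul_smul ..
  · exact edge_mul_smul ..
  · exact ghost_mul_smul ..

/-- Induction on the elements of the Leavitt path algebra. -/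
theorem gen_induction {p : LeavittPathAlgebra R E → Prop} (zero : p 0)
    (add : ∀ x y, p x → p y → p (x + y)) (smul : ∀ (r : R) x, p x → p (r • x))
    (gen : ∀ g, p (gen R E g)) (gen_mul : ∀ g x, p x → p (LeavittPathAlgebra.gen R E g * x))
    (x : LeavittPathAlgebra R E) : p x := by
  obtain ⟨x, rfl⟩ := mk_surjective R E x
  induction x using MonoidAlgebra.induction_linear with
  | zero => rwa [map_zero]
  | add x y hx hy => rw [map_add]; exact add _ _ hx hy
  | single m r =>
    rw [mk_single]
    refine smul _ _ ?_
    induction m using FreeSemigroup.recOnMul with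
    | ih1 g => exact gen g
    | ih2 g m hg hm =>
      have : (.single (.of g * m) 1 : Free R V A) = .single (.of g) 1 * .single m 1 := by
        rw [MonoidAlgebra.single_mul_single, one_mul]
      rw [this, map_mul]
      exact gen_mul g _ hm

/-- The coefficient ring inside the Leavitt path algebra. -/
noncomputable def scalar (R : Type*) [Ring R] [Finite V] (E : DirectedGraph V A) :
    R →+* LeavittPathAlgebra R E where
  toFun r := r • (1 : LeavittPathAlgebra R E)
  map_one' := one_smul ..
  map_mul' a b := by rw [smul_mul_assoc, one_mul, smul_smul]
  map_zero' := zero_smul ..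
  map_add' a b := add_smul ..

theorem scalar_mul [Finite V] (r : R) (x : LeavittPathAlgebra R E) :
    scalar R E r * x = r • x := by
  change (r • (1 : LeavittPathAlgebra R E)) * x = _
  rw [smul_mul_assoc, one_mul]

/-- Scalars need not be central, as `R` may be noncommutative; commuting with the generators is what
`lift` asks for. -/
theorem commute_scalar_gen [Finite V] (r : R) (g : Gen V A) :
    Commute (scalar R E r) (gen R E g) := by
  change _ * _ = _ * (r • (1 : LeavittPathAlgebra R E))
  rw [scalar_mul, gen_mul_smul, mul_one]

end lift

end LeavittPathAlgebra

/-! ### Vertices are nonzero: a representation on functions. -/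

namespace LeavittPathAlgebra

open Leavitt DirectedGraph

section nonvanishing

variable {R V A : Type*} [Ring R]

theorem addMonoidEnd_sum_apply {M ι : Type*} [AddCommGroup M] (s : Finset ι)
    (g : ι → AddMonoid.End M) (x : M) : (∑ i ∈ s, g i) x = ∑ i ∈ s, g i x :=
  AddMonoidHom.finsetSum_apply g s x

theorem toAddMonoidEnd_pi_apply {X : Type*} (r : R) (h : X → R) (x : X) :
    Module.toAddMonoidEnd R (X → R) r h x = r * h x := rfl

/-- Above a vertex `v` that emits edges, `ℕ` is split into infinite pieces indexed by these edges,
using a bijection of `{f // E.s f = v} × ℕ` with `ℕ`. The map `σ` parametrises the pieces and `τ` is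
its partial inverse. -/
theorem exists_branching [Countable A] (E : DirectedGraph V A) :
    ∃ (σ : A × ℕ → V × ℕ) (τ : V × ℕ → Option (A × ℕ)), (∀ p, τ (σ p) = some p) ∧
      (∀ p, (σ p).1 = E.s p.1) ∧ (∀ x p, τ x = some p → σ p = x) ∧
      ∀ x, τ x = none → ∀ f, E.s f ≠ x.1 := by
  classical
  have h : ∀ v, Nonempty {f // E.s f = v} → Nonempty ({f // E.s f = v} × ℕ ≃ ℕ) := by
    intro v hv
    exact nonempty_equiv_of_countable
  let e : ∀ v, Nonempty {f // E.s f = v} → ({f // E.s f = v} × ℕ ≃ ℕ) := fun v hv => (h v hv).some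
  refine ⟨fun p => (E.s p.1, e _ ⟨⟨p.1, rfl⟩⟩ (⟨p.1, rfl⟩, p.2)),
    fun x => if hx : Nonempty {f // E.s f = x.1} then
      some (((e _ hx).symm x.2).1.1, ((e _ hx).symm x.2).2) else none, ?_, fun _ => rfl, ?_, ?_⟩
  · rintro ⟨f, n⟩
    have : Nonempty {g // E.s g = E.s f} := ⟨⟨f, rfl⟩⟩
    simp [this]
  · rintro ⟨v, n⟩ p hp
    dsimp only at hp
    split_ifs at hp with hv
    obtain ⟨⟨⟨f, rfl⟩, m⟩, rfl⟩ := (e v hv).surjective n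
    simp only [Equiv.symm_apply_apply, Option.some.injEq] at hp
    subst hp
    rfl
  · intro x hx f hf
    have : Nonempty {g // E.s g = x.1} := ⟨⟨f, hf⟩⟩
    simp [this] at hx

/-- The operator of a generator on functions, for a system of branching maps. -/
noncomputable def branchingOperator (R : Type*) [Ring R] (E : DirectedGraph V A)
    (σ : A × ℕ → V × ℕ) (τ : V × ℕ → Option (A × ℕ)) : Gen V A → AddMonoid.End (V × ℕ → R) :=
  open Classical in fun
  | .vertex v => AddMonoidHom.mk' (fun h x => if x.1 = v then h x else 0) fun h k => by
      ext x; dsimp; split_ifs <;> simp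
  | .edge f => AddMonoidHom.mk' (fun h x => (τ x).elim 0 fun p =>
      if p.1 = f then h (E.r f, p.2) else 0) fun h k => by
        ext x; dsimp; cases τ x <;> dsimp <;> (try split_ifs) <;> simp
  | .ghost f => AddMonoidHom.mk' (fun h x => if x.1 = E.r f then h (σ (f, x.2)) else 0)
      fun h k => by ext x; dsimp; split_ifs <;> simp

section apply

open Classical

variable (E : DirectedGraph V A) (σ : A × ℕ → V × ℕ) (τ : V × ℕ → Option (A × ℕ))
  (h : V × ℕ → R) (x : V × ℕ)

theorem branchingOperator_vertex (v : V) :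
    branchingOperator R E σ τ (.vertex v) h x = if x.1 = v then h x else 0 := rfl

theorem branchingOperator_edge (f : A) : branchingOperator R E σ τ (.edge f) h x =
    (τ x).elim 0 fun p => if p.1 = f then h (E.r f, p.2) else 0 := rfl

theorem branchingOperator_ghost (f : A) : branchingOperator R E σ τ (.ghost f) h x =
    if x.1 = E.r f then h (σ (f, x.2)) else 0 := rfl

end apply

/-- The edge `f` moves functions on `{r f} × ℕ` to the piece indexed by `f` above `s f`, and the
ghost edge moves them back. Disjointness of the pieces gives relation (3), and their covering the
fibre gives relation (4). -/
theorem isFamily_branchingOperator {E : DirectedGraph V A}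
    {σ : A × ℕ → V × ℕ} {τ : V × ℕ → Option (A × ℕ)} (h₁ : ∀ p, τ (σ p) = some p)
    (h₂ : ∀ p, (σ p).1 = E.s p.1) (h₃ : ∀ x p, τ x = some p → σ p = x)
    (h₄ : ∀ x, τ x = none → ∀ f, E.s f ≠ x.1) : IsFamily E (branchingOperator R E σ τ) where
  vertex_mul_self v := by
    ext h x
    simp [branchingOperator_vertex]
    grind
  vertex_mul_of_ne hvw := by
    ext h x
    simp [branchingOperator_vertex]
    grind
  source_mul_edge f := by
    ext h x
    cases hx : τ x <;>
      simp [branchingOperator_vertex, branchingOperator_edge, hx]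
    grind
  edge_mul_range f := by
    ext h x
    cases hx : τ x <;>
      simp [branchingOperator_vertex, branchingOperator_edge, hx]
  range_mul_ghost f := by
    ext h x
    simp [branchingOperator_vertex, branchingOperator_ghost]
    grind
  ghost_mul_source f := by
    ext h x
    simp [branchingOperator_vertex, branchingOperator_ghost, h₂]
  ghost_mul_edge_self f := by
    ext h x
    simp [branchingOperator_vertex, branchingOperator_ghost,
      branchingOperator_edge, h₁]
    grind
  ghost_mul_edge_of_ne hf := by
    ext h x
    simp [branchingOperator_ghost, branchingOperator_edge, h₁, hf]
  sum_edge_mul_ghost v hfin hne := by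
    classical
    ext h x
    rw [addMonoidEnd_sum_apply, Finset.sum_apply]
    have key : ∀ f, (branchingOperator R E σ τ (.edge f) * branchingOperator R E σ τ (.ghost f)) h x
        = (τ x).elim 0 fun p => if p.1 = f then h (σ (f, p.2)) else 0 := by
      intro f
      cases hx : τ x <;> simp [branchingOperator_ghost, branchingOperator_edge, hx]
    simp only [key, branchingOperator_vertex]
    cases hx : τ x with
    | none =>
      obtain ⟨f, rfl⟩ := hne
      simp [(h₄ x hx f).symm]
    | some p =>
      have := h₃ x p hx
      subst this
      simp [h₂]

theorem vertex_ne_zero [Nontrivial R] [Countable A] (E : DirectedGraph V A) (v : V) :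
    vertex R E v ≠ 0 := by
  obtain ⟨σ, τ, h₁, h₂, h₃, h₄⟩ := exists_branching E
  -- The operators only move or erase coordinates, so they commute with left multiplication by
  -- scalars.
  have hc : ∀ (r : R) (x : Gen V A),
      Commute (Module.toAddMonoidEnd R (V × ℕ → R) r) (branchingOperator R E σ τ x) := by
    intro r x
    ext h y
    cases x
    · simp [toAddMonoidEnd_pi_apply, branchingOperator_vertex]
    · cases hx : τ y <;> simp [toAddMonoidEnd_pi_apply, branchingOperator_edge, hx]
    · simp [toAddMonoidEnd_pi_apply, branchingOperator_ghost]
  intro h0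
  have := lift_gen _ _ hc (isFamily_branchingOperator h₁ h₂ h₃ h₄) (.vertex v)
  change lift _ _ _ _ (vertex R E v) = _ at this
  rw [h0, map_zero] at this
  have := congr_fun (DFunLike.congr_fun this (fun _ => 1)) (v, 0)
  simp [branchingOperator_vertex] at this

end nonvanishing
end LeavittPathAlgebra

/-! ### The grading and the projection onto degree zero. -/

namespace LeavittPathAlgebra

open Leavitt DirectedGraph

section projection

variable {R V A : Type*} [Ring R] [Finite V] {E : DirectedGraph V A}

/-- The degree of a generator. -/
def genDegree : Gen V A → ℤ
  | .vertex _ => 0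
  | .edge _ => 1
  | .ghost _ => -1

/-- Every defining relation is homogeneous for `genDegree`. -/
theorem isFamily_single : IsFamily E
    fun x => (.single (genDegree x) (gen R E x) : AddMonoidAlgebra (LeavittPathAlgebra R E) ℤ) where
  vertex_mul_self v := by
    rw [AddMonoidAlgebra.single_mul_single, isFamily_gen.vertex_mul_self]; rfl
  vertex_mul_of_ne h := by
    rw [AddMonoidAlgebra.single_mul_single, isFamily_gen.vertex_mul_of_ne h]
    exact AddMonoidAlgebra.single_zero _
  source_mul_edge f := by
    rw [AddMonoidAlgebra.single_mul_single, isFamily_gen.source_mul_edge]; rfl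
  edge_mul_range f := by
    rw [AddMonoidAlgebra.single_mul_single, isFamily_gen.edge_mul_range]; rfl
  range_mul_ghost f := by
    rw [AddMonoidAlgebra.single_mul_single, isFamily_gen.range_mul_ghost]; rfl
  ghost_mul_source f := by
    rw [AddMonoidAlgebra.single_mul_single, isFamily_gen.ghost_mul_source]; rfl
  ghost_mul_edge_self f := by
    rw [AddMonoidAlgebra.single_mul_single, isFamily_gen.ghost_mul_edge_self]; rfl
  ghost_mul_edge_of_ne h := by
    rw [AddMonoidAlgebra.single_mul_single, isFamily_gen.ghost_mul_edge_of_ne h]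
    exact AddMonoidAlgebra.single_zero _
  sum_edge_mul_ghost v hfin hne := by
    simp only [AddMonoidAlgebra.single_mul_single]
    rw [← isFamily_gen.sum_edge_mul_ghost v hfin hne]
    exact (map_sum (AddMonoidAlgebra.singleAddHom (0 : ℤ)) _ _).symm

/-- The coaction of `ℤ` on the Leavitt path algebra that defines its grading. -/
noncomputable def coaction (R : Type*) [Ring R] (E : DirectedGraph V A) :
    LeavittPathAlgebra R E →ₙ+* AddMonoidAlgebra (LeavittPathAlgebra R E) ℤ :=
  lift (AddMonoidAlgebra.singleZeroRingHom.comp (scalar R E)) _ (fun r x => by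
    change (AddMonoidAlgebra.single (0 : ℤ) (scalar R E r)) * AddMonoidAlgebra.single _ _ =
      AddMonoidAlgebra.single _ _ * (AddMonoidAlgebra.single (0 : ℤ) (scalar R E r))
    rw [AddMonoidAlgebra.single_mul_single, AddMonoidAlgebra.single_mul_single,
      (commute_scalar_gen r x).eq, zero_add, add_zero]) isFamily_single

theorem coaction_gen (x : Gen V A) :
    coaction R E (gen R E x) = .single (genDegree x) (gen R E x) := lift_gen ..

theorem coaction_smul (r : R) (x : LeavittPathAlgebra R E) :
    coaction R E (r • x) = .single 0 (scalar R E r) * coaction R E x := lift_smul ..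

theorem coaction_path (u : V) (α : List A) :
    coaction R E (path R E u α) = .single (α.length : ℤ) (path R E u α) := by
  induction α generalizing u with
  | nil => exact coaction_gen (.vertex u)
  | cons f α ih =>
    rw [path, map_mul, ih]
    refine (congr_arg (· * _) (coaction_gen (.edge f))).trans ?_
    rw [AddMonoidAlgebra.single_mul_single]
    simp only [genDegree, List.length_cons, Nat.cast_add, Nat.cast_one, add_comm (1 : ℤ)]
    rfl

theorem coaction_ghostPath (u : V) (α : List A) :
    coaction R E (ghostPath R E u α) = .single (-α.length : ℤ) (ghostPath R E u α) := by
  induction α generalizing u with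
  | nil => exact coaction_gen (.vertex u)
  | cons f α ih =>
    rw [ghostPath, map_mul, ih]
    refine (congr_arg (_ * ·) (coaction_gen (.ghost f))).trans ?_
    rw [AddMonoidAlgebra.single_mul_single]
    simp only [genDegree, List.length_cons, Nat.cast_add, Nat.cast_one, neg_add]
    rfl

/-- This makes the coefficient at `n` of the coaction restrict to the identity on the component of
degree `n`. -/
theorem coaction_of_mem_component {n : ℤ} {x : LeavittPathAlgebra R E}
    (hx : x ∈ component R E n) : coaction R E x = .single n x := by
  induction hx using AddSubgroup.closure_induction with
  | zero => rw [map_zero, AddMonoidAlgebra.single_zero]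
  | add x y _ _ hx hy => rw [map_add, hx, hy, AddMonoidAlgebra.single_add]
  | neg x _ hx => rw [map_neg, hx, AddMonoidAlgebra.single_neg]
  | mem x hx =>
    obtain ⟨c, u, v, w, α, β, -, -, rfl, rfl⟩ := hx
    rw [coaction_smul, map_mul, coaction_path, coaction_ghostPath,
      AddMonoidAlgebra.single_mul_single, AddMonoidAlgebra.single_mul_single, scalar_mul, zero_add,
      sub_eq_add_neg]

theorem smul_mem_component (r : R) {n : ℤ} {x : LeavittPathAlgebra R E}
    (hx : x ∈ component R E n) : r • x ∈ component R E n := by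
  induction hx using AddSubgroup.closure_induction with
  | zero => rw [smul_zero]; exact zero_mem _
  | add x y _ _ hx hy => rw [smul_add]; exact add_mem hx hy
  | neg x _ hx => rw [smul_neg]; exact neg_mem hx
  | mem x hx =>
    obtain ⟨c, u, v, w, α, β, h₁, h₂, h₃, rfl⟩ := hx
    exact AddSubgroup.subset_closure ⟨r * c, u, v, w, α, β, h₁, h₂, h₃, smul_smul ..⟩

theorem gen_mem_component (x : Gen V A) : gen R E x ∈ component R E (genDegree x) := by
  refine AddSubgroup.subset_closure ?_
  cases x with
  | vertex v => exact ⟨1, v, v, v, [], [], rfl, rfl, rfl, by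
      rw [one_smul]; exact (vertex_mul_self v).symm⟩
  | edge f => exact ⟨1, E.s f, E.r f, E.r f, [f], [], ⟨rfl, rfl⟩, rfl, rfl, by
      rw [one_smul, path, path, ghostPath, edge_mul_range, edge_mul_range]; rfl⟩
  | ghost f => exact ⟨1, E.r f, E.s f, E.r f, [], [f], rfl, ⟨rfl, rfl⟩, rfl, by
      rw [one_smul, path, ghostPath, ghostPath, range_mul_ghost, range_mul_ghost]; rfl⟩

theorem coeff_coaction_mem (x : LeavittPathAlgebra R E) :
    ∀ n, (coaction R E x).coeff n ∈ component R E n := by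
  induction x using gen_induction with
  | zero => intro n; rw [map_zero]; exact zero_mem _
  | add x y hx hy => intro n; rw [map_add]; exact add_mem (hx n) (hy n)
  | smul r x hx =>
    intro n
    rw [coaction_smul, AddMonoidAlgebra.coeff_single_zero_mul, scalar_mul]
    exact smul_mem_component r (hx n)
  | gen g =>
    intro n
    rw [coaction_gen, AddMonoidAlgebra.coeff_single, Finsupp.single_apply]
    split_ifs with h
    · exact h ▸ gen_mem_component g
    · exact zero_mem _
  | gen_mul g x hx =>
    intro n
    rw [map_mul, coaction_gen, AddMonoidAlgebra.coeff_single_mul_apply]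
    have := mul_mem_component (gen_mem_component (R := R) (E := E) g) (hx (-genDegree g + n))
    rwa [add_neg_cancel_left] at this

/-- The projection of the Leavitt path algebra onto its component of degree zero. -/
noncomputable def componentProjection (R : Type*) [Ring R] (E : DirectedGraph V A) :
    LeavittPathAlgebra R E →+ component R E 0 where
  toFun x := ⟨(coaction R E x).coeff 0, coeff_coaction_mem x 0⟩
  map_zero' := by ext; simp
  map_add' x y := by ext; simp

/-- The inclusion of the component of degree zero. -/
noncomputable def componentSubtype (R : Type*) [Ring R] (E : DirectedGraph V A) :
    component R E 0 →+* LeavittPathAlgebra R E where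
  toFun := Subtype.val
  map_one' := rfl
  map_mul' _ _ := rfl
  map_zero' := rfl
  map_add' _ _ := rfl

theorem componentProjection_subtype (s : component R E 0) :
    componentProjection R E (componentSubtype R E s) = s := by
  ext
  change (coaction R E (s : LeavittPathAlgebra R E)).coeff 0 = s
  rw [coaction_of_mem_component s.2]
  simp

theorem componentProjection_mul_subtype (x : LeavittPathAlgebra R E) (s : component R E 0) :
    componentProjection R E (x * componentSubtype R E s) = componentProjection R E x * s := by
  ext
  change (coaction R E (x * (s : LeavittPathAlgebra R E))).coeff 0 = (coaction R E x).coeff 0 * s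
  rw [map_mul, coaction_of_mem_component s.2, AddMonoidAlgebra.coeff_mul_single_zero]

theorem componentProjection_subtype_mul (s : component R E 0) (x : LeavittPathAlgebra R E) :
    componentProjection R E (componentSubtype R E s * x) = s * componentProjection R E x := by
  ext
  change (coaction R E ((s : LeavittPathAlgebra R E) * x)).coeff 0 = s * (coaction R E x).coeff 0
  rw [map_mul, coaction_of_mem_component s.2, AddMonoidAlgebra.coeff_single_zero_mul]

theorem isNoetherianRing_component [IsNoetherianRing (LeavittPathAlgebra R E)] :
    IsNoetherianRing (component R E 0) :=
  isNoetherianRing_of_retraction (componentSubtype R E) (componentProjection R E)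
    componentProjection_subtype componentProjection_mul_subtype

/-- Passing to opposites turns left linearity of the projection into the right linearity that the
retraction lemma uses. -/
theorem isNoetherianRing_component_op [IsNoetherianRing (LeavittPathAlgebra R E)ᵐᵒᵖ] :
    IsNoetherianRing (component R E 0)ᵐᵒᵖ :=
  isNoetherianRing_of_retraction (RingHom.op (componentSubtype R E))
    (AddMonoidHom.mulOp (componentProjection R E))
    (fun s => congr_arg MulOpposite.op (componentProjection_subtype s.unop))
    (fun x s => congr_arg MulOpposite.op (componentProjection_subtype_mul s.unop x.unop))

end projection

/-! ### The star anti-homomorphism and opposite rings. -/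

section opposite

open MulOpposite

variable {R S V A : Type*} [Ring R] [Ring S] [Finite V] {E : DirectedGraph V A}

/-- The involution of the generators. -/
def genStar : Gen V A → Gen V A
  | .vertex v => .vertex v
  | .edge f => .ghost f
  | .ghost f => .edge f

theorem isFamily_op : IsFamily E fun x => op (gen S E (genStar x)) where
  vertex_mul_self v := congr_arg op (isFamily_gen.vertex_mul_self v)
  vertex_mul_of_ne h := congr_arg op (isFamily_gen.vertex_mul_of_ne h.symm)
  source_mul_edge f := congr_arg op (isFamily_gen.ghost_mul_source f)
  edge_mul_range f := congr_arg op (isFamily_gen.range_mul_ghost f)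
  range_mul_ghost f := congr_arg op (isFamily_gen.edge_mul_range f)
  ghost_mul_source f := congr_arg op (isFamily_gen.source_mul_edge f)
  ghost_mul_edge_self f := congr_arg op (isFamily_gen.ghost_mul_edge_self f)
  ghost_mul_edge_of_ne h := congr_arg op (isFamily_gen.ghost_mul_edge_of_ne h.symm)
  sum_edge_mul_ghost v hfin hne := by
    refine Eq.trans ?_ (congr_arg op (isFamily_gen.sum_edge_mul_ghost v hfin hne))
    rw [Finset.op_sum]
    rfl

/-- The anti-homomorphism of Leavitt path algebras that exchanges real and ghost edges. -/
noncomputable def starHom (τ : R →+* Sᵐᵒᵖ) (E : DirectedGraph V A) :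
    LeavittPathAlgebra R E →ₙ+* (LeavittPathAlgebra S E)ᵐᵒᵖ :=
  lift ((RingHom.op (scalar S E)).comp τ) _
    (fun r x => (commute_scalar_gen (τ r).unop (genStar x)).op) isFamily_op

theorem starHom_gen (τ : R →+* Sᵐᵒᵖ) (x : Gen V A) :
    starHom τ E (gen R E x) = op (gen S E (genStar x)) := lift_gen ..

theorem starHom_smul (τ : R →+* Sᵐᵒᵖ) (r : R) (x : LeavittPathAlgebra R E) :
    starHom τ E (r • x) = op (scalar S E (τ r).unop) * starHom τ E x := lift_smul ..

theorem starHom_one (τ : R →+* Sᵐᵒᵖ) : starHom τ E 1 = 1 := by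
  let _ := Fintype.ofFinite V
  change starHom τ E (∑ v, vertex R E v) = op (∑ v, vertex S E v)
  rw [map_sum, Finset.op_sum]
  exact Finset.sum_congr rfl fun v _ => starHom_gen τ (.vertex v)

theorem starHom_surjective (τ : R →+* Sᵐᵒᵖ) (hτ : Function.Surjective τ) :
    Function.Surjective (starHom τ E) := by
  have hgen : ∀ g : Gen V A, starHom τ E (gen R E (genStar g)) = op (gen S E g) := by
    intro g
    rw [starHom_gen]
    cases g <;> rfl
  have key : ∀ y : LeavittPathAlgebra S E, ∃ x, starHom τ E x = op y := by
    intro y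
    induction y using gen_induction with
    | zero => exact ⟨0, map_zero _⟩
    | add x y hx hy =>
      obtain ⟨x', hx'⟩ := hx
      obtain ⟨y', hy'⟩ := hy
      exact ⟨x' + y', by rw [map_add, hx', hy', op_add]⟩
    | smul s x hx =>
      obtain ⟨x', hx'⟩ := hx
      obtain ⟨r, hr⟩ := hτ (op s)
      -- The scalar stands on the right because the map reverses products.
      refine ⟨x' * (r • 1), ?_⟩
      rw [map_mul, starHom_smul, starHom_one, mul_one, hx', hr, ← op_mul, unop_op, scalar_mul]
    | gen g => exact ⟨_, hgen g⟩
    | gen_mul g x hx =>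
      obtain ⟨x', hx'⟩ := hx
      exact ⟨x' * gen R E (genStar g), by rw [map_mul, hx', hgen, op_mul]⟩
  exact fun y => key y.unop

/-- The noetherian property passes to quotients, so injectivity of the star map plays no role. -/
theorem isNoetherianRing_of_anti_surjective (τ : R →+* Sᵐᵒᵖ) (hτ : Function.Surjective τ)
    [IsNoetherianRing (LeavittPathAlgebra R E)] : IsNoetherianRing (LeavittPathAlgebra S E)ᵐᵒᵖ :=
  isNoetherianRing_of_surjective (LeavittPathAlgebra R E) (LeavittPathAlgebra S E)ᵐᵒᵖ
    { starHom τ E with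
      map_one' := starHom_one τ
      map_zero' := map_zero (starHom τ E) } (starHom_surjective τ hτ)

end opposite
end LeavittPathAlgebra

/-! ### Closed paths with an exit at the base. -/

namespace DirectedGraph

variable {V A : Type*} {E : DirectedGraph V A}

theorem isPath_append_iff {u w : V} {p q : List A} :
    E.IsPath u (p ++ q) w ↔ ∃ v, E.IsPath u p v ∧ E.IsPath v q w := by
  induction p generalizing u with
  | nil => simp [IsPath]
  | cons f p ih => simp [IsPath, ih, and_assoc]

/-- The cycle is rotated so that the exit leaves from its base vertex. -/
theorem exists_closed_path_of_not_conditionNE (h : ¬ E.ConditionNE) :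
    ∃ (g : A) (q : List A) (e : A), E.IsPath (E.s g) (g :: q) (E.s g) ∧ E.s e = E.s g ∧ e ≠ g := by
  simp only [ConditionNE, not_forall, not_not] at h
  obtain ⟨c, hc, e, g, hg, hse, hne⟩ := h
  obtain ⟨l₁, l₂, rfl⟩ := List.append_of_mem hg
  have hp : ∃ v, E.IsPath v (l₁ ++ g :: l₂) v := by
    rcases hl : l₁ ++ g :: l₂ with _ | ⟨f, p⟩
    · rw [hl] at hc; exact hc.elim
    · rw [hl] at hc; exact ⟨_, hc.1⟩
  obtain ⟨v, hv⟩ := hp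
  obtain ⟨w, h₁, h₂⟩ := isPath_append_iff.1 hv
  obtain rfl := h₂.1
  exact ⟨g, l₂ ++ l₁, e, isPath_append_iff (p := g :: l₂).2 ⟨v, h₂, h₁⟩, hse, hne⟩

end DirectedGraph

/-! ### Decreasing idempotents from an exit. -/

namespace LeavittPathAlgebra

open DirectedGraph

section chain

variable {R V A : Type*} [Ring R] {E : DirectedGraph V A}

theorem path_mul_vertex {u w : V} {p : List A} (h : E.IsPath u p w) :
    path R E u p * vertex R E w = path R E u p := by
  induction p generalizing u with
  | nil => cases h; exact vertex_mul_self _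
  | cons f p ih => rw [path, mul_assoc, ih h.2]

theorem vertex_mul_ghostPath {u w : V} {p : List A} (h : E.IsPath u p w) :
    vertex R E w * ghostPath R E u p = ghostPath R E u p := by
  induction p generalizing u with
  | nil => cases h; exact vertex_mul_self _
  | cons f p ih => rw [ghostPath, ← mul_assoc, ih h.2]

theorem ghostPath_mul_path_self {u w : V} {p : List A} (h : E.IsPath u p w) :
    ghostPath R E u p * path R E u p = vertex R E w := by
  induction p generalizing u with
  | nil => cases h; exact vertex_mul_self _
  | cons f p ih =>
    rw [ghostPath, path, mul_assoc, ← mul_assoc (ghost R E f), ghost_mul_edge_self,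
      vertex_mul_path h.2, ih h.2]

theorem path_mem_component {u w : V} {p : List A} (h : E.IsPath u p w) :
    path R E u p ∈ component R E p.length :=
  AddSubgroup.subset_closure ⟨1, u, w, w, p, [], h, rfl, by simp, by
    rw [one_smul, ghostPath, path_mul_vertex h]⟩

theorem ghostPath_mem_component {u w : V} {p : List A} (h : E.IsPath u p w) :
    ghostPath R E u p ∈ component R E (-p.length) :=
  AddSubgroup.subset_closure ⟨1, w, u, w, [], p, rfl, h, by simp, by
    rw [one_smul, path, vertex_mul_ghostPath h]⟩

/-- The projections `cᵏ (c*)ᵏ` of a closed path `c` at `v`. -/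
noncomputable def closedPathProjection (R : Type*) [Ring R] (E : DirectedGraph V A) (v : V)
    (q : List A) : ℕ → LeavittPathAlgebra R E
  | 0 => vertex R E v
  | k + 1 => path R E v q * closedPathProjection R E v q k * ghostPath R E v q

variable {v : V} {q : List A}

theorem closedPathProjection_mem_component (hq : E.IsPath v q v) (k : ℕ) :
    closedPathProjection R E v q k ∈ component R E 0 := by
  induction k with
  | zero => exact path_mem_component (p := []) (rfl : v = v)
  | succ k ih =>
    have := mul_mem_component (mul_mem_component (path_mem_component (R := R) hq) ih)
      (ghostPath_mem_component hq)
    simpa [closedPathProjection] using this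

theorem vertex_mul_closedPathProjection (hq : E.IsPath v q v) (k : ℕ) :
    vertex R E v * closedPathProjection R E v q k = closedPathProjection R E v q k := by
  cases k with
  | zero => exact vertex_mul_self v
  | succ k => rw [closedPathProjection, ← mul_assoc, ← mul_assoc, vertex_mul_path hq]

theorem closedPathProjection_mul_vertex (hq : E.IsPath v q v) (k : ℕ) :
    closedPathProjection R E v q k * vertex R E v = closedPathProjection R E v q k := by
  cases k with
  | zero => exact vertex_mul_self v
  | succ k => rw [closedPathProjection, mul_assoc, ghostPath_mul_vertex hq]

/-- The inner factor `c* c` collapses to `v`. This lowers both exponents and drives the inductions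
below. -/
theorem closedPathProjection_succ_mul_succ (hq : E.IsPath v q v) (k l : ℕ) :
    closedPathProjection R E v q (k + 1) * closedPathProjection R E v q (l + 1) =
      path R E v q * (closedPathProjection R E v q k * closedPathProjection R E v q l) *
        ghostPath R E v q := by
  have : closedPathProjection R E v q (k + 1) * closedPathProjection R E v q (l + 1) =
      path R E v q * (closedPathProjection R E v q k * ((ghostPath R E v q * path R E v q) *
        closedPathProjection R E v q l)) * ghostPath R E v q := by
    simp only [closedPathProjection, mul_assoc]
  rw [this, ghostPath_mul_path_self hq, vertex_mul_closedPathProjection hq]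

theorem closedPathProjection_mul_succ (hq : E.IsPath v q v) (k : ℕ) :
    closedPathProjection R E v q k * closedPathProjection R E v q (k + 1) =
      closedPathProjection R E v q (k + 1) := by
  induction k with
  | zero => exact vertex_mul_closedPathProjection hq 1
  | succ k ih => rw [closedPathProjection_succ_mul_succ hq, ih, ← closedPathProjection]

theorem closedPathProjection_succ_mul (hq : E.IsPath v q v) (k : ℕ) :
    closedPathProjection R E v q (k + 1) * closedPathProjection R E v q k =
      closedPathProjection R E v q (k + 1) := by
  induction k with
  | zero => exact closedPathProjection_mul_vertex hq 1
  | succ k ih => rw [closedPathProjection_succ_mul_succ hq, ih, ← closedPathProjection]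

theorem closedPathProjection_mul_self (hq : E.IsPath v q v) (k : ℕ) :
    closedPathProjection R E v q k * closedPathProjection R E v q k =
      closedPathProjection R E v q k := by
  induction k with
  | zero => exact vertex_mul_self v
  | succ k ih => rw [closedPathProjection_succ_mul_succ hq, ih, ← closedPathProjection]

theorem ghostPath_mul_closedPathProjection_mul_path (hq : E.IsPath v q v) (k : ℕ) :
    ghostPath R E v q * closedPathProjection R E v q (k + 1) * path R E v q =
      closedPathProjection R E v q k := by
  have : ghostPath R E v q * closedPathProjection R E v q (k + 1) * path R E v q =
      (ghostPath R E v q * path R E v q) * (closedPathProjection R E v q k *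
        (ghostPath R E v q * path R E v q)) := by
    simp only [closedPathProjection, mul_assoc]
  rw [this, ghostPath_mul_path_self hq, closedPathProjection_mul_vertex hq,
    vertex_mul_closedPathProjection hq]

/-- Conjugating by `c` reduces an equality to `c c* = v`. Multiplying that by `e*` on the left gives
`e* = 0`, since `e* g = 0`; then `r e = e* e = 0`, contradicting `vertex_ne_zero`. -/
theorem closedPathProjection_succ_ne [Nontrivial R] [Countable A] {g e : A} {q : List A}
    (hq : E.IsPath (E.s g) (g :: q) (E.s g)) (he : E.s e = E.s g) (hne : e ≠ g) (k : ℕ) :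
    closedPathProjection R E (E.s g) (g :: q) (k + 1) ≠
      closedPathProjection R E (E.s g) (g :: q) k := by
  induction k with
  | zero =>
    intro h
    have h₁ : ghost R E e * vertex R E (E.s g) = 0 := by
      change _ = vertex R E _ at h
      rw [← h, closedPathProjection, path, ← mul_assoc, ← mul_assoc, ← mul_assoc,
        ghost_mul_edge_of_ne hne]
      simp
    rw [← he, ghost_mul_source] at h₁
    apply vertex_ne_zero (R := R) E (E.r e)
    rw [← ghost_mul_edge_self, h₁, zero_mul]
  | succ k ih =>
    intro h
    apply ih
    rw [← ghostPath_mul_closedPathProjection_mul_path hq (k + 1), h,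
      ghostPath_mul_closedPathProjection_mul_path hq]

theorem exists_idempotents_component [Nontrivial R] [Finite V] [Countable A] (h : ¬ E.ConditionNE) :
    ∃ p : ℕ → component R E 0, (∀ k, p k * p (k + 1) = p (k + 1)) ∧
      (∀ k, p (k + 1) * p k = p (k + 1)) ∧ (∀ k, p k * p k = p k) ∧ ∀ k, p (k + 1) ≠ p k := by
  obtain ⟨g, q, e, hq, he, hne⟩ := exists_closed_path_of_not_conditionNE h
  exact ⟨fun k => ⟨_, closedPathProjection_mem_component hq k⟩,
    fun k => Subtype.ext (closedPathProjection_mul_succ hq k),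
    fun k => Subtype.ext (closedPathProjection_succ_mul hq k),
    fun k => Subtype.ext (closedPathProjection_mul_self hq k),
    fun k h => closedPathProjection_succ_ne hq he hne k (congr_arg Subtype.val h)⟩

theorem conditionNE_of_isNoetherianRing_component [Nontrivial R] [Finite V] [Countable A]
    (h : IsNoetherianRing (component R E 0)) : E.ConditionNE := by
  by_contra hE
  obtain ⟨p, h₁, h₂, h₃, h₄⟩ := exists_idempotents_component (R := R) hE
  exact not_isNoetherianRing_of_idempotents p h₁ h₂ h₃ h₄ h

theorem conditionNE_of_isNoetherianRing_component_op [Nontrivial R] [Finite V] [Countable A]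
    (h : IsNoetherianRing (component R E 0)ᵐᵒᵖ) : E.ConditionNE := by
  by_contra hE
  obtain ⟨p, h₁, h₂, h₃, h₄⟩ := exists_idempotents_component (R := R) hE
  exact not_isNoetherianRing_of_idempotents (fun k => MulOpposite.op (p k))
    (fun k => congr_arg MulOpposite.op (h₂ k)) (fun k => congr_arg MulOpposite.op (h₁ k))
    (fun k => congr_arg MulOpposite.op (h₃ k)) (fun k h => h₄ k (MulOpposite.op_injective h)) h

end chain

end LeavittPathAlgebra

/-! ### Graphs whose cycles have no exit. -/

namespace DirectedGraph

variable {V A : Type*} {E : DirectedGraph V A}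

/-- The vertex `v` lies on a closed path. -/
def OnClosedPath (E : DirectedGraph V A) (v : V) : Prop :=
  ∃ f p, E.IsPath v (f :: p) v

/-- A closed path that revisits its base is cut there. The first edge survives, so every edge on a
closed path starts a cycle. -/
theorem exists_isCycle_of_isPath (n : ℕ) : ∀ {v : V} {f : A} {p : List A}, p.length < n →
    E.IsPath v (f :: p) v → ∃ q, E.IsCycle (f :: q) := by
  induction n with
  | zero => intro _ _ _ h; lia
  | succ n ih =>
    intro v f p hn hp
    by_cases h : ∀ g ∈ p, E.s g ≠ E.s f
    · obtain rfl := hp.1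
      exact ⟨p, hp, h⟩
    · push Not at h
      obtain ⟨g, hg, hgf⟩ := h
      obtain ⟨l₁, l₂, rfl⟩ := List.append_of_mem hg
      obtain ⟨w, h₁, h₂⟩ := isPath_append_iff (p := f :: l₁).1 hp
      have : w = v := by rw [← h₂.1, hgf, hp.1]
      subst this
      refine ih ?_ h₁
      simp only [List.length_append, List.length_cons] at hn
      lia

theorem ConditionNE.eq_of_isPath (hE : E.ConditionNE) {v : V} {f g : A} {p : List A}
    (hp : E.IsPath v (f :: p) v) (hg : E.s g = v) : g = f := by
  obtain ⟨q, hq⟩ := exists_isCycle_of_isPath _ (Nat.lt_succ_self _) hp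
  by_contra h
  exact hE _ hq ⟨g, f, List.mem_cons_self, hg.trans hp.1.symm, h⟩

theorem onClosedPath_range {v : V} {f : A} {p : List A} (hp : E.IsPath v (f :: p) v) :
    E.OnClosedPath (E.r f) := by
  have : E.IsPath (E.r f) (p ++ [f]) (E.r f) := isPath_append_iff.2 ⟨v, hp.2, hp.1, rfl⟩
  rcases h : p ++ [f] with _ | ⟨g, q⟩
  · simp at h
  · exact ⟨g, q, h ▸ this⟩

theorem OnClosedPath.exists_edge {v : V} (hv : E.OnClosedPath v) :
    ∃ f p, E.r f = v ∧ E.IsPath (E.s f) (f :: p) (E.s f) := by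
  obtain ⟨g, q, hq⟩ := hv
  obtain ⟨l, f, hl⟩ := (List.eq_nil_or_concat (g :: q)).resolve_left (by simp)
  rw [List.concat_eq_append] at hl
  rw [hl] at hq
  obtain ⟨w, h₁, rfl, h₂⟩ := isPath_append_iff.1 hq
  exact ⟨f, l, h₂, rfl, by rwa [show E.r f = v from h₂]⟩

/-- The function `out` selects the edges of the cycles of a graph in which no cycle has an exit. -/
structure IsCycleSelection (E : DirectedGraph V A) (out : V → Option A) : Prop where
  source_iff {v : V} {f : A} (h : out v = some f) (g : A) : E.s g = v ↔ g = f
  -- This map follows the selected edge on cycles and fixes all other vertices; its bijectivity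
  -- makes the shift invertible.
  bijective : Function.Bijective fun v => (out v).elim v E.r
  isSome_range {v : V} {f : A} (h : out v = some f) : (out (E.r f)).isSome
  wellFounded : WellFounded fun w v => out v = none ∧ ∃ f, E.s f = v ∧ E.r f = w

theorem exists_isPath_of_transGen {P : V → Prop} {w v : V}
    (h : Relation.TransGen (fun w v => P v ∧ ∃ f, E.s f = v ∧ E.r f = w) w v) :
    P v ∧ ∃ f p, E.IsPath v (f :: p) w := by
  induction h with
  | single h =>
    obtain ⟨hv, f, rfl, rfl⟩ := h
    exact ⟨hv, f, [], rfl, rfl⟩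
  | tail _ h ih =>
    obtain ⟨hv, f, rfl, rfl⟩ := h
    obtain ⟨-, g, p, hp⟩ := ih
    exact ⟨hv, f, g :: p, rfl, hp⟩

theorem ConditionNE.exists_isCycleSelection [Finite V] (hE : E.ConditionNE) :
    ∃ out, E.IsCycleSelection out := by
  classical
  let out : V → Option A := fun v => if h : E.OnClosedPath v then some h.choose else none
  have h₁ : ∀ v f, out v = some f ↔ ∃ p, E.IsPath v (f :: p) v := by
    intro v f
    by_cases h : E.OnClosedPath v
    · simp only [out, dif_pos h, Option.some.injEq]
      constructor
      · rintro rfl; exact h.choose_spec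
      · rintro ⟨p, hp⟩
        obtain ⟨q, hq⟩ := h.choose_spec
        exact hE.eq_of_isPath hp hq.1
    · simp only [out, dif_neg h, reduceCtorEq, false_iff]
      exact fun hp => h ⟨f, hp⟩
  have h₂ : ∀ v, out v = none → ¬ E.OnClosedPath v := by
    rintro v hv ⟨f, hf⟩
    rw [(h₁ v f).2 hf] at hv
    cases hv
  refine ⟨out, ⟨?_, ?_, ?_, ?_⟩⟩
  · intro v f hf g
    obtain ⟨p, hp⟩ := (h₁ v f).1 hf
    exact ⟨hE.eq_of_isPath hp, fun h => h ▸ hp.1⟩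
  -- On a finite set surjectivity suffices: a vertex on a closed path is the range of the last edge
  -- of that path.
  · refine Finite.surjective_iff_bijective.1 fun v => ?_
    by_cases hv : E.OnClosedPath v
    · obtain ⟨f, p, rfl, hp⟩ := hv.exists_edge
      exact ⟨E.s f, by rw [(h₁ _ f).2 ⟨p, hp⟩]; rfl⟩
    · refine ⟨v, ?_⟩
      simp only [out, dif_neg hv]
      rfl
  · intro v f hf
    obtain ⟨p, hp⟩ := (h₁ v f).1 hf
    obtain ⟨g, hg⟩ := onClosedPath_range hp
    rw [(h₁ _ g).2 hg]
    rfl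
  · let r : V → V → Prop := fun w v => out v = none ∧ ∃ f, E.s f = v ∧ E.r f = w
    -- A loop of this relation would be a closed path through a vertex that lies on none.
    have : Std.Irrefl (Relation.TransGen r) :=
      ⟨fun v h => by
        obtain ⟨hv, hp⟩ := exists_isPath_of_transGen (P := fun v => out v = none) h
        exact h₂ v hv hp⟩
    exact Subrelation.wf (fun h => Relation.TransGen.single (r := r) h)
      (Finite.wellFounded_of_trans_of_irrefl (Relation.TransGen r))

/-- The paths that end as soon as they reach a sink or a cycle. -/
inductive IsEntry (E : DirectedGraph V A) (out : V → Option A) : V → List A → Prop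
  | nil (v : V) (h : (out v).isSome ∨ ∀ f, E.s f ≠ v) : IsEntry E out v []
  | cons (f : A) (p : List A) (h : out (E.s f) = none) (hp : IsEntry E out (E.r f) p) :
      IsEntry E out (E.s f) (f :: p)

/-- Well-founded induction on the starting vertex: an entry is empty or begins with one of finitely
many edges. -/
theorem IsCycleSelection.finite_isEntry [Finite V] [Finite A] {out : V → Option A}
    (h : E.IsCycleSelection out) : {x : V × List A | E.IsEntry out x.1 x.2}.Finite := by
  have key : ∀ v, {p | E.IsEntry out v p}.Finite := by
    intro v
    induction v using h.wellFounded.induction with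
    | _ v ih =>
      refine Set.Finite.subset (s := {[]} ∪ ⋃ f : {f : A // E.s f = v ∧ out v = none},
        (List.cons f.1) '' {p | E.IsEntry out (E.r f.1) p}) ?_ ?_
      · refine (Set.finite_singleton _).union (Set.finite_iUnion fun f => (ih _ ?_).image _)
        exact ⟨f.2.2, f.1, f.2.1, rfl⟩
      · rintro p (_ | ⟨f, p, hf, hp⟩)
        · exact .inl rfl
        · exact .inr (Set.mem_iUnion.2 ⟨⟨f, rfl, hf⟩, p, hp, rfl⟩)
  refine (Set.finite_iUnion fun v => (key v).image (Prod.mk v)).subset ?_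
  rintro ⟨v, p⟩ hp
  exact Set.mem_iUnion.2 ⟨v, p, hp, rfl⟩

end DirectedGraph

/-! ### The shift and the noetherian property of the algebra. -/

namespace LeavittPathAlgebra

open DirectedGraph Leavitt

section noetherian

variable {R V A : Type*} [Ring R] {E : DirectedGraph V A} {out : V → Option A}

/-- This plays the role of `1 = ∑ p p*` over the entries `p`: relation (4) expands a vertex
repeatedly until it reaches sinks and cycles. -/
theorem mem_of_ghostPath_mul_mem [Finite V] [Finite A] (h : E.IsCycleSelection out)
    (N : Ideal (LeavittPathAlgebra R E)) (x : LeavittPathAlgebra R E)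
    (hx : ∀ v p, E.IsEntry out v p → ghostPath R E v p * x ∈ N) : x ∈ N := by
  have key : ∀ v, ∀ x : LeavittPathAlgebra R E,
      (∀ p, E.IsEntry out v p → ghostPath R E v p * x ∈ N) → vertex R E v * x ∈ N := by
    intro v
    induction v using h.wellFounded.induction with
    | _ v ih =>
      intro x hx
      by_cases hv : (out v).isSome ∨ ∀ f, E.s f ≠ v
      · exact hx [] (.nil v hv)
      · push Not at hv
        obtain ⟨hv, f, hf⟩ := hv
        replace hv := Option.not_isSome_iff_eq_none.1 hv
        rw [← sum_edge_mul_ghost v (Set.toFinite _) ⟨f, hf⟩, Finset.sum_mul]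
        refine sum_mem fun g hg => ?_
        obtain rfl : E.s g = v := by simpa using hg
        rw [mul_assoc]
        refine N.mul_mem_left _ ?_
        rw [← range_mul_ghost, mul_assoc]
        refine ih _ ⟨hv, g, rfl, rfl⟩ _ fun p hp => ?_
        rw [← mul_assoc]
        exact hx _ (.cons g p hv hp)
  let _ := Fintype.ofFinite V
  rw [← sum_vertex_mul x, Finset.sum_mul]
  exact sum_mem fun v _ => key v x (hx v)

theorem ghostPath_mul_vertex_of_isEntry {v : V} {p : List A} (h : E.IsEntry out v p) :
    ghostPath R E v p * vertex R E v = ghostPath R E v p := by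
  cases h with
  | nil => exact vertex_mul_self v
  | cons f p => rw [ghostPath, mul_assoc, ghost_mul_source]

/-- Relation (4) has a single summand here, so each cycle edge has its ghost as a two-sided inverse
between corners. -/
theorem sum_edge_mul_ghost_of_unique {f : A} (h : ∀ g, E.s g = E.s f → g = f) :
    edge R E f * ghost R E f = vertex R E (E.s f) := by
  have hs : {g : A | E.s g = E.s f} = {f} := by
    ext g
    exact ⟨h g, fun hg => congr_arg E.s hg⟩
  have hfin : {g : A | E.s g = E.s f}.Finite := hs ▸ Set.finite_singleton f
  rw [← sum_edge_mul_ghost (E.s f) hfin ⟨f, rfl⟩]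
  have : hfin.toFinset = {f} := by
    ext g
    simpa using ⟨h g, fun hg => congr_arg E.s hg⟩
  rw [this, Finset.sum_singleton]

/-- The summand at `v` of the shift along the cycles. -/
noncomputable def shiftAt (R : Type*) [Ring R] (E : DirectedGraph V A) (out : V → Option A)
    (v : V) : LeavittPathAlgebra R E := (out v).elim (vertex R E v) (edge R E)

/-- The summand at `v` of the inverse shift along the cycles. -/
noncomputable def unshiftAt (R : Type*) [Ring R] (E : DirectedGraph V A) (out : V → Option A)
    (v : V) : LeavittPathAlgebra R E := (out v).elim (vertex R E v) (ghost R E)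

/-- The successor of a vertex along the cycles. -/
def next (E : DirectedGraph V A) (out : V → Option A) (v : V) : V := (out v).elim v E.r

theorem vertex_mul_shiftAt (h : E.IsCycleSelection out) (v : V) :
    vertex R E v * shiftAt R E out v = shiftAt R E out v := by
  unfold shiftAt
  cases hv : out v with
  | none => exact vertex_mul_self v
  | some f =>
    obtain rfl := (h.source_iff hv f).2 rfl
    exact source_mul_edge f

theorem shiftAt_mul_vertex (v : V) :
    shiftAt R E out v * vertex R E (next E out v) = shiftAt R E out v := by
  unfold shiftAt next
  cases hv : out v with
  | none => exact vertex_mul_self v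
  | some f => exact edge_mul_range f

theorem vertex_mul_unshiftAt (v : V) :
    vertex R E (next E out v) * unshiftAt R E out v = unshiftAt R E out v := by
  unfold unshiftAt next
  cases hv : out v with
  | none => exact vertex_mul_self v
  | some f => exact range_mul_ghost f

theorem unshiftAt_mul_vertex (h : E.IsCycleSelection out) (v : V) :
    unshiftAt R E out v * vertex R E v = unshiftAt R E out v := by
  unfold unshiftAt
  cases hv : out v with
  | none => exact vertex_mul_self v
  | some f =>
    obtain rfl := (h.source_iff hv f).2 rfl
    exact ghost_mul_source f

theorem shiftAt_mul_unshiftAt (h : E.IsCycleSelection out) (v : V) :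
    shiftAt R E out v * unshiftAt R E out v = vertex R E v := by
  unfold shiftAt unshiftAt
  cases hv : out v with
  | none => exact vertex_mul_self v
  | some f =>
    obtain rfl := (h.source_iff hv f).2 rfl
    exact sum_edge_mul_ghost_of_unique fun g => (h.source_iff hv g).1

theorem unshiftAt_mul_shiftAt (v : V) :
    unshiftAt R E out v * shiftAt R E out v = vertex R E (next E out v) := by
  unfold shiftAt unshiftAt next
  cases hv : out v with
  | none => exact vertex_mul_self v
  | some f => exact ghost_mul_edge_self f

theorem one_eq_sum_vertex [Fintype V] : (1 : LeavittPathAlgebra R E) = ∑ v, vertex R E v := by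
  rw [← sum_vertex_mul (1 : LeavittPathAlgebra R E), mul_one]

/-- Injectivity of `next` leaves only one summand that does not annihilate `x`. -/
theorem sum_shiftAt_mul [Fintype V] (h : E.IsCycleSelection out) (v : V)
    {x : LeavittPathAlgebra R E} (hx : vertex R E (next E out v) * x = x) :
    (∑ w, shiftAt R E out w) * x = shiftAt R E out v * x := by
  rw [Finset.sum_mul]
  refine Finset.sum_eq_single v (fun w _ hw => ?_) fun hv => absurd (Finset.mem_univ v) hv
  rw [← hx, ← shiftAt_mul_vertex, mul_assoc, ← mul_assoc (vertex R E _),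
    vertex_mul_of_ne (v := next E out w) (w := next E out v) fun h' => hw (h.bijective.injective h'), zero_mul, mul_zero]

theorem sum_unshiftAt_mul [Fintype V] (h : E.IsCycleSelection out) (v : V)
    {x : LeavittPathAlgebra R E} (hx : vertex R E v * x = x) :
    (∑ w, unshiftAt R E out w) * x = unshiftAt R E out v * x := by
  rw [Finset.sum_mul]
  refine Finset.sum_eq_single v (fun w _ hw => ?_) fun hv => absurd (Finset.mem_univ v) hv
  rw [← hx, ← unshiftAt_mul_vertex h, mul_assoc, ← mul_assoc (vertex R E _),
    vertex_mul_of_ne hw, zero_mul, mul_zero]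

/-- The unit of the Leavitt path algebra that shifts along the cycles. -/
noncomputable def shift [Fintype V] (R : Type*) [Ring R] (h : E.IsCycleSelection out) :
    (LeavittPathAlgebra R E)ˣ where
  val := ∑ v, shiftAt R E out v
  inv := ∑ v, unshiftAt R E out v
  val_inv := by
    rw [Finset.mul_sum, one_eq_sum_vertex]
    refine Finset.sum_congr rfl fun v _ => ?_
    rw [sum_shiftAt_mul h v (vertex_mul_unshiftAt v), shiftAt_mul_unshiftAt h]
  inv_val := by
    -- The products `u_v* u_v` are the vertices `next v`, so `1` is reindexed along `next`.
    rw [Finset.mul_sum, one_eq_sum_vertex, ← h.bijective.sum_comp fun v => vertex R E v]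
    refine Finset.sum_congr rfl fun v _ => ?_
    rw [sum_unshiftAt_mul h v (vertex_mul_shiftAt h v), unshiftAt_mul_shiftAt]
    rfl

theorem shift_mul_vertex_range [Fintype V] (h : E.IsCycleSelection out) {f : A}
    (hf : out (E.s f) = some f) : (shift R h).val * vertex R E (E.r f) = edge R E f := by
  have hn : next E out (E.s f) = E.r f := by simp [next, hf]
  refine (sum_shiftAt_mul h (E.s f) (by rw [hn, vertex_mul_self])).trans ?_
  simp only [shiftAt, hf, Option.elim]
  exact edge_mul_range f

theorem shift_mul_ghost [Fintype V] (h : E.IsCycleSelection out) {f : A}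
    (hf : out (E.s f) = some f) : (shift R h).val * ghost R E f = vertex R E (E.s f) := by
  have hn : next E out (E.s f) = E.r f := by simp [next, hf]
  refine (sum_shiftAt_mul h (E.s f) (by rw [hn, range_mul_ghost])).trans ?_
  simp only [shiftAt, hf, Option.elim]
  exact sum_edge_mul_ghost_of_unique fun g => (h.source_iff hf g).1

/-- Over a noncommutative `R`, evaluating polynomials at the shift is multiplicative because of
this. -/
theorem commute_scalar_shift [Fintype V] (h : E.IsCycleSelection out) (r : R) :
    Commute (scalar R E r) (shift R h).val := by
  refine Commute.sum_right _ _ _ fun v _ => ?_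
  unfold shiftAt
  cases out v with
  | none => exact commute_scalar_gen r (.vertex v)
  | some f => exact commute_scalar_gen r (.edge f)

open Polynomial in
/-- The polynomials in the shift. -/
noncomputable def shiftHom [Fintype V] (R : Type*) [Ring R] (h : E.IsCycleSelection out) :
    R[X] →+* LeavittPathAlgebra R E :=
  eval₂RingHom' (scalar R E) (shift R h).val (commute_scalar_shift h)

open Polynomial in
theorem shiftHom_C [Fintype V] (h : E.IsCycleSelection out) (r : R) :
    shiftHom R h (C r) = scalar R E r := eval₂_C ..

open Polynomial in
theorem shiftHom_X [Fintype V] (h : E.IsCycleSelection out) :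
    shiftHom R h X = (shift R h).val := eval₂_X ..

/-- The left action of the polynomials in the shift. -/
@[reducible]
noncomputable def shiftModule [Fintype V] (R : Type*) [Ring R] (h : E.IsCycleSelection out) :
    Module (Polynomial R) (LeavittPathAlgebra R E) := Module.compHom _ (shiftHom R h)

open Polynomial in
/-- Up to powers of `X`, a submodule of a module over a polynomial ring. -/
def powerSaturation {R L : Type*} [Ring R] [AddCommGroup L] [Module R[X] L]
    (M : Submodule R[X] L) : Submodule R[X] L where
  carrier := {y | ∃ k : ℕ, (X ^ k : R[X]) • y ∈ M}
  zero_mem' := ⟨0, by simp⟩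
  add_mem' := by
    rintro y z ⟨k, hk⟩ ⟨l, hl⟩
    refine ⟨k + l, ?_⟩
    rw [smul_add]
    refine add_mem ?_ ?_
    · rw [add_comm, pow_add, mul_smul]; exact M.smul_mem _ hk
    · rw [pow_add, mul_smul]; exact M.smul_mem _ hl
  smul_mem' := by
    rintro p y ⟨k, hk⟩
    -- Powers of `X` commute with all polynomials, even for noncommutative `R`.
    exact ⟨k, by rw [smul_smul, X_pow_mul, mul_smul]; exact M.smul_mem _ hk⟩

open Polynomial in
theorem mem_powerSaturation_of_X_pow_smul {R L : Type*} [Ring R] [AddCommGroup L] [Module R[X] L]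
    {M : Submodule R[X] L} {k : ℕ} {y : L} (h : (X ^ k : R[X]) • y ∈ powerSaturation M) :
    y ∈ powerSaturation M := by
  obtain ⟨l, hl⟩ := h
  exact ⟨l + k, by rwa [pow_add, mul_smul]⟩

-- Right multiplication by `t` is `R[X]`-linear, so a check on the spanning set is enough.
open Polynomial in
theorem mul_mem_powerSaturation {R L : Type*} [Ring R] [Ring L] [Module R[X] L]
    [IsScalarTower R[X] L L] {s : Set L} {t : L}
    (h : ∀ y ∈ s, y * t ∈ powerSaturation (Submodule.span R[X] s)) {y : L}
    (hy : y ∈ powerSaturation (Submodule.span R[X] s)) :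
    y * t ∈ powerSaturation (Submodule.span R[X] s) := by
  obtain ⟨k, hk⟩ := hy
  refine mem_powerSaturation_of_X_pow_smul (k := k) ?_
  rw [← smul_mul_assoc]
  generalize (X ^ k : R[X]) • y = z at hk
  induction hk using Submodule.span_induction with
  | mem x hx => exact h x hx
  | zero => rw [zero_mul]; exact zero_mem _
  | add x y _ _ hx hy => rw [add_mul]; exact add_mem hx hy
  | smul p x _ hx => rw [smul_mul_assoc]; exact Submodule.smul_mem _ _ hx

/-- The ghost paths of the entries. -/
def entryGhosts (R : Type*) [Ring R] (E : DirectedGraph V A) (out : V → Option A) :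
    Set (LeavittPathAlgebra R E) :=
  (fun x : V × List A => ghostPath R E x.1 x.2) '' {x | E.IsEntry out x.1 x.2}

theorem mem_entryGhosts {v : V} {p : List A} (hp : E.IsEntry out v p) :
    ghostPath R E v p ∈ entryGhosts R E out := ⟨(v, p), hp, rfl⟩

-- When the product with `p*` is nonzero, an edge off the cycles cancels a letter of `p`, a cycle
-- edge `f` equals `u * r f`, and a ghost edge off the cycles lengthens the entry. Only a cycle
-- ghost may leave the span, and there `u * f* = s f`: hence the saturation.
open Polynomial in
theorem ghostPath_mul_mem_powerSaturation [Fintype V] (h : E.IsCycleSelection out)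
    (x t : LeavittPathAlgebra R E) (hx : x ∈ entryGhosts R E out)
    (ht : (∃ g, t = gen R E g) ∨ ∃ r, t = scalar R E r) :
    letI := shiftModule R h
    x * t ∈ powerSaturation (Submodule.span R[X] (entryGhosts R E out)) := by
  let := shiftModule R h
  have hle : ∀ y ∈ Submodule.span R[X] (entryGhosts R E out),
      y ∈ powerSaturation (Submodule.span R[X] (entryGhosts R E out)) :=
    fun y hy => ⟨0, by simpa using hy⟩
  have hmem : ∀ {v p}, E.IsEntry out v p →
      ghostPath R E v p ∈ powerSaturation (Submodule.span R[X] (entryGhosts R E out)) :=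
    fun hp => hle _ (Submodule.subset_span (mem_entryGhosts hp))
  have hX : ∀ y : LeavittPathAlgebra R E, (X : R[X]) • y = (shift R h).val * y := fun y =>
    congr_arg (· * y) (shiftHom_X h)
  obtain ⟨⟨v, p⟩, hp, rfl⟩ := hx
  change E.IsEntry out v p at hp
  change ghostPath R E v p * t ∈ _
  obtain ⟨g, rfl⟩ | ⟨r, rfl⟩ := ht
  · cases g with
    | vertex w =>
      change _ * vertex R E w ∈ _
      by_cases hw : v = w
      · subst hw
        rw [ghostPath_mul_vertex_of_isEntry hp]
        exact hmem hp
      · rw [← ghostPath_mul_vertex_of_isEntry hp, mul_assoc, vertex_mul_of_ne hw, mul_zero]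
        exact zero_mem _
    | edge f =>
      change _ * edge R E f ∈ _
      cases hp with
      | nil _ hv =>
        by_cases hf : v = E.s f
        · subst hf
          obtain ⟨f', hf'⟩ := Option.isSome_iff_exists.1 (hv.resolve_right fun h' => h' f rfl)
          obtain rfl := (h.source_iff hf' f).1 rfl
          rw [ghostPath, source_mul_edge, ← shift_mul_vertex_range h hf', ← hX]
          exact Submodule.smul_mem _ _ (hmem (.nil _ (.inl (h.isSome_range hf'))))
        · rw [ghostPath, ← source_mul_edge, ← mul_assoc, vertex_mul_of_ne hf, zero_mul]
          exact zero_mem _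
      | cons g p hg hp =>
        rw [ghostPath, mul_assoc]
        by_cases hgf : g = f
        · subst hgf
          rw [ghost_mul_edge_self, ghostPath_mul_vertex_of_isEntry hp]
          exact hmem hp
        · rw [ghost_mul_edge_of_ne hgf, mul_zero]
          exact zero_mem _
    | ghost f =>
      change _ * ghost R E f ∈ _
      by_cases hv : v = E.r f
      · subst hv
        cases hf : out (E.s f) with
        | none => exact hmem (.cons f p hf hp)
        | some f' =>
          obtain rfl := (h.source_iff hf f).1 rfl
          have hs := h.isSome_range hf
          refine mem_powerSaturation_of_X_pow_smul (k := 1) ?_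
          rw [pow_one, hX]
          -- The vertex `r f` lies on a cycle, so its only entry is the trivial one.
          generalize hw : E.r f = w at hp hs
          cases hp with
          | nil =>
            rw [ghostPath, ← hw, range_mul_ghost, shift_mul_ghost h hf]
            exact hmem (.nil _ (.inl (by rw [hf]; rfl)))
          | cons g p hg => rw [hg] at hs; cases hs
      · rw [← ghostPath_mul_vertex_of_isEntry hp, ← range_mul_ghost, mul_assoc,
          ← mul_assoc (vertex R E v), vertex_mul_of_ne hv, zero_mul, mul_zero]
        exact zero_mem _
  · have : ghostPath R E v p * scalar R E r = (C r : R[X]) • ghostPath R E v p := by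
      change _ * (r • (1 : LeavittPathAlgebra R E)) = shiftHom R h (C r) * _
      rw [shiftHom_C, scalar_mul, ghostPath_mul_smul, mul_one]
    rw [this]
    exact Submodule.smul_mem _ _ (hmem hp)

open Polynomial in
theorem isNoetherianRing_of_isCycleSelection [Finite V] [Finite A] [IsNoetherianRing R]
    (h : E.IsCycleSelection out) : IsNoetherianRing (LeavittPathAlgebra R E) := by
  let := Fintype.ofFinite V
  let := shiftModule R h
  have : IsScalarTower R[X] (LeavittPathAlgebra R E) (LeavittPathAlgebra R E) :=
    ⟨fun p x y => mul_assoc (shiftHom R h p) x y⟩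
  have := isNoetherianRing_polynomial R
  let M : Submodule R[X] (LeavittPathAlgebra R E) := Submodule.span R[X] (entryGhosts R E out)
  have : IsNoetherian R[X] M := isNoetherian_span_of_finite _ (h.finite_isEntry.image _)
  -- The saturation of `M` is stable under right multiplication by the whole algebra.
  have hright : ∀ t y : LeavittPathAlgebra R E, y ∈ powerSaturation M →
      y * t ∈ powerSaturation M := by
    intro t
    induction t using gen_induction with
    | zero => intro y _; rw [mul_zero]; exact zero_mem _
    | add s t hs ht => intro y hy; rw [mul_add]; exact add_mem (hs y hy) (ht y hy)
    | smul r t ht =>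
      intro y hy
      rw [← scalar_mul, ← mul_assoc]
      exact ht _ (mul_mem_powerSaturation
        (fun x hx => ghostPath_mul_mem_powerSaturation h x _ hx (.inr ⟨r, rfl⟩)) hy)
    | gen g =>
      intro y hy
      exact mul_mem_powerSaturation
        (fun x hx => ghostPath_mul_mem_powerSaturation h x _ hx (.inl ⟨g, rfl⟩)) hy
    | gen_mul g t ht =>
      intro y hy
      rw [← mul_assoc]
      exact ht _ (mul_mem_powerSaturation
        (fun x hx => ghostPath_mul_mem_powerSaturation h x _ hx (.inl ⟨g, rfl⟩)) hy)
  refine isNoetherianRing_of_mem_span_inf M fun x => ?_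
  refine mem_of_ghostPath_mul_mem h _ x fun v p hp => ?_
  obtain ⟨k, hk⟩ := hright x _ ⟨0, by
    rw [pow_zero, one_smul]; exact Submodule.subset_span (mem_entryGhosts hp)⟩
  have hXk : (X ^ k : R[X]) • (ghostPath R E v p * x) =
      (shift R h ^ k).val * (ghostPath R E v p * x) := by
    change shiftHom R h (X ^ k) * _ = _
    rw [map_pow, shiftHom_X, Units.val_pow_eq_pow_val]
  rw [hXk] at hk
  -- Inverting the shift puts `p* x` into the left ideal generated by `u ^ k p* x`, which lies both
  -- in `M` and in the left ideal of `x`.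
  rw [← Units.inv_mul_cancel_left (shift R h ^ k) (ghostPath R E v p * x)]
  refine Ideal.mul_mem_left _ _ (Ideal.subset_span ⟨hk, ?_⟩)
  exact Ideal.mul_mem_left _ _ (Ideal.mul_mem_left _ _ (Ideal.mem_span_singleton_self x))

end noetherian

theorem isNoetherianRing_of_conditionNE {R V A : Type*} [Ring R] [Finite V] [Finite A]
    [IsNoetherianRing R] {E : DirectedGraph V A} (hE : E.ConditionNE) :
    IsNoetherianRing (LeavittPathAlgebra R E) :=
  let ⟨_, h⟩ := hE.exists_isCycleSelection
  isNoetherianRing_of_isCycleSelection h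

end LeavittPathAlgebra

theorem mainTheorem5 {R : Type*} [Ring R] [Nontrivial R] {V A : Type*} [Finite V] [Finite A]
    (E : DirectedGraph V A) :
    (IsNoetherianRing R →
      List.TFAE [E.ConditionNE,
        IsNoetherianRing (LeavittPathAlgebra.component R E 0),
        IsNoetherianRing (LeavittPathAlgebra R E)]) ∧
    (IsNoetherianRing Rᵐᵒᵖ →
      List.TFAE [E.ConditionNE,
        IsNoetherianRing (LeavittPathAlgebra.component R E 0)ᵐᵒᵖ,
        IsNoetherianRing (LeavittPathAlgebra R E)ᵐᵒᵖ]) := by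
  refine ⟨fun hR => ?_, fun hR => ?_⟩
  · tfae_have 1 → 3 := LeavittPathAlgebra.isNoetherianRing_of_conditionNE
    tfae_have 3 → 2 := fun _ => LeavittPathAlgebra.isNoetherianRing_component
    tfae_have 2 → 1 := LeavittPathAlgebra.conditionNE_of_isNoetherianRing_component
    tfae_finish
  -- The left-hand result is applied over `Rᵐᵒᵖ` and carried to the opposite algebra by the star
  -- map.
  · tfae_have 1 → 3 := fun hE => by
      have := LeavittPathAlgebra.isNoetherianRing_of_conditionNE (R := Rᵐᵒᵖ) hE
      exact LeavittPathAlgebra.isNoetherianRing_of_anti_surjective (RingHom.id Rᵐᵒᵖ)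
        Function.surjective_id
    tfae_have 3 → 2 := fun _ => LeavittPathAlgebra.isNoetherianRing_component_op
    tfae_have 2 → 1 := LeavittPathAlgebra.conditionNE_of_isNoetherianRing_component_op
    tfae_finish
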